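/- Let $\Omega\subset\mathbb R^3$ be a bounded open set (in particular, a bounded region with Lipschitz boundary), let $0<V_0<|\Omega|$, and let $\lambda,\varepsilon,\omega_p,\omega_a,\omega_v>0$, $A<0$, $B,C>0$ be real constants. Let $\mathcal S_0$ be the space of symmetric traceless real $3\times 3$ matrices and put $$s_+=\frac{B+\sqrt{B^2-24AC}}{4C},\qquad \bar F_b(\mathbf Q)=\frac1C\Big(\frac A2\operatorname{tr}\mathbf Q^2-\frac B3\operatorname{tr}\mathbf Q^3+\frac C4(\operatorname{tr}\mathbf Q^2)^2\Big).$$ Let $H_0^1(\Omega)$ be the closure of $C_c^\infty(\Omega)$ in $H^1(\Omega)$, and let $H_0^1(\Omega;\mathcal S_0)$ be the space of $\mathcal S_0$-valued functions all of whose entries belong to $H_0^1(\Omega)$. Consider the nondimensional diffuse-interface Landau–de Gennes energy $$\begin{aligned}E_\varepsilon[\mathbf Q,\phi]=&\int_\Omega\Big[\tfrac12|\nabla\mathbf Q|^2+\lambda^2\bar F_b(\mathbf Q)\Big]dx+\omega_p\lambda\int_\Omega\Big[\varepsilon|\nabla\phi|^2+\tfrac1\varepsilon\phi^2(1-\phi)^2\Big]dx\\&+\omega_a\lambda\int_\Omega\varepsilon\Big|\Big(\mathbf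 Q+\frac{s_+}3\mathbf I\Big)\nabla\phi\Big|^2dx+\omega_v\lambda^2\int_\Omega\tfrac12(1-\phi)^2|\mathbf Q|^2dx,\end{aligned}$$ where $|\nabla\mathbf Q|^2=\sum_{i,j,k}|\partial_kQ^{ij}|^2$, $|\mathbf Q|^2=\sum_{i,j}|Q^{ij}|^2$, and the integrals are Lebesgue integrals of functions bounded below, with values in $(-\infty,+\infty]$. Then $E_\varepsilon$ has at least one global minimizer in the admissible set $$\mathscr A=\Big\{(\mathbf Q,\phi):\ \mathbf Q\in H_0^1(\Omega;\mathcal S_0),\ \phi\in H_0^1(\Omega),\ \int_\Omega\phi\,dx=V_0\Big\},$$ that is, there is $(\mathbf Q^*_\varepsilon,\phi^*_\varepsilon)\in\mathscr A$ such that $E_\varepsilon[\mathbf Q^*_\varepsilon,\phi^*_\varepsilon]$ is finite and $E_\varepsilon[\mathbf Q^*_\varepsilon,\phi^*_\varepsilon]\le E_\varepsilon[\mathbf Q,\phi]$ for all $(\mathbf Q,\phi)\in\mathscr A$. -/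

import Mathlib

open MeasureTheory Filter Topology
open scoped ENNReal Matrix ContDiff

noncomputable section

namespace LdG

/-- Three-dimensional Euclidean space. -/
abbrev E3 : Type := EuclideanSpace ℝ (Fin 3)

/-! ### The Sobolev space with zero boundary values -/

/-- The test functions of class `C_c^∞(Ω)`, extended by zero to the whole space. -/
structure IsTestFunction (Ω : Set E3) (ψ : E3 → ℝ) : Prop where
  contDiff : ContDiff ℝ ∞ ψ
  hasCompactSupport : HasCompactSupport ψ
  tsupport_subset : tsupport ψ ⊆ Ω

/-- `g` is a weak gradient of `u` in `Ω`. -/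
structure HasWeakGradient (Ω : Set E3) (u : E3 → ℝ) (g : E3 → E3) : Prop where
  locallyIntegrableOn : LocallyIntegrableOn u Ω volume
  locallyIntegrableOn_gradient : LocallyIntegrableOn g Ω volume
  integral_eq : ∀ ψ : E3 → ℝ, IsTestFunction Ω ψ → ∀ k : Fin 3,
    ∫ x in Ω, u x * gradient ψ x k = - ∫ x in Ω, g x k * ψ x

open Classical in
/-- The weak gradient of `u` in `Ω`. If `Ω` is open, it is unique up to equality almost everywhere
in `Ω`; it is `0` by convention if `u` is not weakly differentiable. -/
def weakGradient (Ω : Set E3) (u : E3 → ℝ) : E3 → E3 :=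
  if h : ∃ g, HasWeakGradient Ω u g then h.choose else 0

/-- `u ∈ H^1(Ω)`: `u` is in `L^2(Ω)` and has a weak gradient in `L^2(Ω)`. -/
structure MemH1 (Ω : Set E3) (u : E3 → ℝ) : Prop where
  memLp : MemLp u 2 (volume.restrict Ω)
  exists_weakGradient : ∃ g, HasWeakGradient Ω u g
  memLp_weakGradient : MemLp (weakGradient Ω u) 2 (volume.restrict Ω)

/-- `u ∈ H_0^1(Ω)`: `u` is in the closure of `C_c^∞(Ω)` with respect to the norm of `H^1(Ω)`. -/
structure MemH10 (Ω : Set E3) (u : E3 → ℝ) : Prop where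
  memH1 : MemH1 Ω u
  exists_approx : ∃ ψ : ℕ → E3 → ℝ, (∀ n, IsTestFunction Ω (ψ n)) ∧
    Tendsto (fun n => eLpNorm (fun x => ψ n x - u x) 2 (volume.restrict Ω)) atTop (𝓝 0) ∧
    Tendsto (fun n => eLpNorm (fun x => gradient (ψ n) x - weakGradient Ω u x) 2
      (volume.restrict Ω)) atTop (𝓝 0)

/-- The space `S_0` of symmetric traceless `3 × 3` matrices. -/
def S0 : Submodule ℝ (Matrix (Fin 3) (Fin 3) ℝ) where
  carrier := {Q | Qᵀ = Q ∧ Q.trace = 0}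
  add_mem' := by
    rintro a b ⟨ha, ha'⟩ ⟨hb, hb'⟩
    exact ⟨by rw [Matrix.transpose_add, ha, hb], by rw [Matrix.trace_add, ha', hb', add_zero]⟩
  zero_mem' := ⟨Matrix.transpose_zero, Matrix.trace_zero _ _⟩
  smul_mem' := by
    rintro c a ⟨ha, ha'⟩
    exact ⟨by rw [Matrix.transpose_smul, ha], by rw [Matrix.trace_smul, ha', smul_zero]⟩

/-- The entry `Q^{ij}` of a tensor field. -/
def entry (Q : E3 → S0) (i j : Fin 3) : E3 → ℝ :=
  fun x => (Q x : Matrix (Fin 3) (Fin 3) ℝ) i j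

/-- `Q ∈ H_0^1(Ω; S_0)`: every entry of the `S_0`-valued function `Q` is in `H_0^1(Ω)`. -/
def MemH10S0 (Ω : Set E3) (Q : E3 → S0) : Prop :=
  ∀ i j : Fin 3, MemH10 Ω (entry Q i j)

/-! ### The energy -/

/-- The squared Frobenius norm `|Q|² = ∑_{i,j} |Q^{ij}|²`. -/
def frobSq (M : Matrix (Fin 3) (Fin 3) ℝ) : ℝ :=
  ∑ i, ∑ j, M i j ^ 2

/-- `|∇Q|² = ∑_{i,j,k} |∂_k Q^{ij}|²`. -/
def gradSq (Ω : Set E3) (Q : E3 → S0) (x : E3) : ℝ :=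
  ∑ i, ∑ j, ∑ k, (weakGradient Ω (entry Q i j) x k) ^ 2

/-- The constant `s_+`. -/
def sPlus (A B C : ℝ) : ℝ :=
  (B + √(B ^ 2 - 24 * A * C)) / (4 * C)

/-- The bulk energy density `F_b`. -/
def bulk (A B C : ℝ) (M : Matrix (Fin 3) (Fin 3) ℝ) : ℝ :=
  A / 2 * (M ^ 2).trace - B / 3 * (M ^ 3).trace + C / 4 * ((M ^ 2).trace) ^ 2

/-- The Lebesgue integral of `f` over `Ω` with values in `[-∞, ∞]`: the integral of the positive
part minus the integral of the negative part. It is used below only for densities that are bounded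
below, so that over a bounded `Ω` the second of these integrals is finite. -/
def extIntegral (Ω : Set E3) (f : E3 → ℝ) : EReal :=
  ((∫⁻ x in Ω, ENNReal.ofReal (f x) : ℝ≥0∞) : EReal) -
    ((∫⁻ x in Ω, ENNReal.ofReal (-f x) : ℝ≥0∞) : EReal)

/-- The nondimensional constants of the model (all bars dropped), and the material constants
`A < 0`, `B > 0`, `C > 0` of the bulk energy. -/
structure Params where
  (lam eps ωp ωa ωv A B C : ℝ)
  lam_pos : 0 < lam
  eps_pos : 0 < eps
  ωp_pos : 0 < ωp
  ωa_pos : 0 < ωa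
  ωv_pos : 0 < ωv
  A_neg : A < 0
  B_pos : 0 < B
  C_pos : 0 < C

/-- The nondimensional Landau-de Gennes energy, with the rescaled bulk energy density `F_b / C`. -/
def energyLdG (p : Params) (Ω : Set E3) (Q : E3 → S0) : EReal :=
  extIntegral Ω fun x => 1 / 2 * gradSq Ω Q x + p.lam ^ 2 * (bulk p.A p.B p.C (Q x) / p.C)

/-- The mixing energy. -/
def energyMix (p : Params) (Ω : Set E3) (φ : E3 → ℝ) : EReal :=
  extIntegral Ω fun x =>
    p.eps * ‖weakGradient Ω φ x‖ ^ 2 + p.eps⁻¹ * (φ x ^ 2 * (1 - φ x) ^ 2)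

/-- The anchoring energy. It is infinite for some `Q` and `φ` of class `H_0^1`. -/
def energyAnch (p : Params) (Ω : Set E3) (Q : E3 → S0) (φ : E3 → ℝ) : EReal :=
  extIntegral Ω fun x =>
    p.eps * ‖WithLp.toLp 2 (((Q x : Matrix (Fin 3) (Fin 3) ℝ) +
      (sPlus p.A p.B p.C / 3) • (1 : Matrix (Fin 3) (Fin 3) ℝ)) *ᵥ
        (weakGradient Ω φ x).ofLp)‖ ^ 2

/-- The void energy. -/
def energyVoid (Ω : Set E3) (Q : E3 → S0) (φ : E3 → ℝ) : EReal :=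
  extIntegral Ω fun x => 1 / 2 * (1 - φ x) ^ 2 * frobSq (Q x)

/-- The nondimensional diffuse-interface Landau-de Gennes energy `E_ε`, as a functional of the pair
`(Q, φ)`. -/
def energy (p : Params) (Ω : Set E3) (q : (E3 → S0) × (E3 → ℝ)) : EReal :=
  energyLdG p Ω q.1
    + ((p.ωp * p.lam : ℝ) : EReal) * energyMix p Ω q.2
    + ((p.ωa * p.lam : ℝ) : EReal) * energyAnch p Ω q.1 q.2
    + ((p.ωv * p.lam ^ 2 : ℝ) : EReal) * energyVoid Ω q.1 q.2

/-- The admissible set: `Q ∈ H_0^1(Ω; S_0)` and `φ ∈ H_0^1(Ω)` with `∫_Ω φ = V₀`. -/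
def admissible (Ω : Set E3) (V₀ : ℝ) : Set ((E3 → S0) × (E3 → ℝ)) :=
  {q | MemH10S0 Ω q.1 ∧ MemH10 Ω q.2 ∧ ∫ x in Ω, q.2 x = V₀}

end LdG

end

/-!
The proof is the direct method of the calculus of variations.

*Reduction.* The quartic term of the bulk energy dominates the cubic one, so that the rescaled bulk
density is at least `|Q|² - c` (`exists_frobSq_le_bulk`). Hence, on admissible pairs, the energy with
values in `EReal` differs by the constant `c |Ω|` from a sum `shiftedEnergy` of integrals of
nonnegative functions (`energy_eq`), and it suffices to minimize that sum in `ℝ≥0∞`. It is finite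
for `Q = 0` and a suitable bump function `φ`.

*Compactness.* By coercivity (`exists_bound_of_shiftedEnergy_le`; the `L²` bounds come from the
two potentials, so Poincaré's inequality is not needed) the entries of a minimizing sequence are
bounded in `H_0^1`, and some subsequence converges in `L²` and almost everywhere, with weakly
convergent gradients (`exists_subseq_H10Tendsto`). Three facts carry this: bounded sequences in
`L²` have weakly convergent subsequences (sequential Banach-Alaoglu); the closure in `L² × L²` of
the pairs `(ψ, ∇ψ)` of test functions is weakly closed, so that the limit is again in `H_0^1`
(`exists_tendsto_of_weakTendsto`); and Rellich's theorem (`tendsto_eLpNorm_zero_of_weakTendsto`),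
proved by comparing a test function with its averages over small balls. The boundary of `Ω` plays
no role, since test functions extend by zero.

*Lower semicontinuity.* The terms without gradients are handled by Fatou's lemma. All the others
have the form `∫ |M g|²` with `M` converging almost everywhere and `g` converging weakly; the
anchoring term, where `M = Q + s_+/3 I` is unbounded, needs the truncation argument of
`lintegral_enorm_sq_le_liminf`.
-/

noncomputable section

namespace LdG

/-! ### Weak convergence in `L²` -/

section WeakConvergence

variable {X E F : Type*} [MeasurableSpace X] {μ : Measure X}
  [NormedAddCommGroup E] [InnerProductSpace ℝ E]
  [NormedAddCommGroup F] [InnerProductSpace ℝ F]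

/-- Weak convergence `f n ⇀ f₀` in `L²(μ; E)`, tested against all square integrable `w`. Membership
of the functions in `L²` is not part of the definition. -/
def WeakTendsto (μ : Measure X) (f : ℕ → X → E) (f₀ : X → E) : Prop :=
  ∀ w : X → E, MemLp w 2 μ →
    Tendsto (fun n => ∫ x, inner ℝ (f n x) (w x) ∂μ) atTop (𝓝 (∫ x, inner ℝ (f₀ x) (w x) ∂μ))

lemma WeakTendsto.comp_strictMono {f : ℕ → X → E} {f₀ : X → E} (h : WeakTendsto μ f f₀)
    {σ : ℕ → ℕ} (hσ : StrictMono σ) : WeakTendsto μ (fun n => f (σ n)) f₀ :=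
  fun w hw => (h w hw).comp hσ.tendsto_atTop

lemma integral_inner_eq_inner_toLp {a b : X → E} (ha : MemLp a 2 μ) (hb : MemLp b 2 μ) :
    ∫ x, inner ℝ (a x) (b x) ∂μ = inner ℝ (ha.toLp a) (hb.toLp b) := by
  rw [L2.inner_def]
  refine integral_congr_ae ?_
  filter_upwards [ha.coeFn_toLp, hb.coeFn_toLp] with x h1 h2
  rw [h1, h2]

lemma integrable_inner_of_memLp {a b : X → E} (ha : MemLp a 2 μ) (hb : MemLp b 2 μ) :
    Integrable (fun x => inner ℝ (a x) (b x)) μ := by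
  refine (L2.integrable_inner (𝕜 := ℝ) (ha.toLp a) (hb.toLp b)).congr ?_
  filter_upwards [ha.coeFn_toLp, hb.coeFn_toLp] with x h1 h2
  rw [h1, h2]

lemma abs_integral_inner_le {a b : X → E} (ha : MemLp a 2 μ) (hb : MemLp b 2 μ) :
    |∫ x, inner ℝ (a x) (b x) ∂μ| ≤ (eLpNorm a 2 μ).toReal * (eLpNorm b 2 μ).toReal := by
  rw [integral_inner_eq_inner_toLp ha hb]
  refine (abs_real_inner_le_norm _ _).trans ?_
  rw [Lp.norm_toLp, Lp.norm_toLp]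

/-- If `a n` is bounded in `L²` and `b n → 0` in `L²`, then `∫ ⟪a n, b n⟫ → 0`. -/
lemma tendsto_integral_inner_zero {a b : ℕ → X → E} {R : ℝ} (ha : ∀ n, MemLp (a n) 2 μ)
    (hR : ∀ n, (eLpNorm (a n) 2 μ).toReal ≤ R) (hb : ∀ n, MemLp (b n) 2 μ)
    (hb0 : Tendsto (fun n => eLpNorm (b n) 2 μ) atTop (𝓝 0)) :
    Tendsto (fun n => ∫ x, inner ℝ (a n x) (b n x) ∂μ) atTop (𝓝 0) := by
  have h1 : Tendsto (fun n => R * (eLpNorm (b n) 2 μ).toReal) atTop (𝓝 0) := by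
    have := ((ENNReal.tendsto_toReal ENNReal.zero_ne_top).comp hb0).const_mul R
    simpa using this
  refine squeeze_zero_norm (fun n => ?_) h1
  rw [Real.norm_eq_abs]
  exact (abs_integral_inner_le (ha n) (hb n)).trans
    (mul_le_mul_of_nonneg_right (hR n) ENNReal.toReal_nonneg)

/-- Convergence in `L²` implies weak convergence. -/
lemma weakTendsto_of_eLpNorm {f : ℕ → X → E} {f₀ : X → E} (hf : ∀ n, MemLp (f n) 2 μ)
    (hf₀ : MemLp f₀ 2 μ)
    (h : Tendsto (fun n => eLpNorm (fun x => f n x - f₀ x) 2 μ) atTop (𝓝 0)) :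
    WeakTendsto μ f f₀ := by
  intro w hw
  have h1 := tendsto_integral_inner_zero (a := fun _ => w) (b := fun n x => f n x - f₀ x)
    (fun _ => hw) (fun _ => le_rfl) (fun n => (hf n).sub hf₀) h
  have h2 : ∀ n, ∫ x, inner ℝ (w x) (f n x - f₀ x) ∂μ =
      ∫ x, inner ℝ (f n x) (w x) ∂μ - ∫ x, inner ℝ (f₀ x) (w x) ∂μ := by
    intro n
    rw [← integral_sub (integrable_inner_of_memLp (hf n) hw) (integrable_inner_of_memLp hf₀ hw)]
    refine integral_congr_ae (Eventually.of_forall fun x => ?_)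
    simp only [inner_sub_right, real_inner_comm]
  simp only [h2] at h1
  exact tendsto_sub_nhds_zero_iff.mp h1

lemma WeakTendsto.sub {f g : ℕ → X → E} {f₀ g₀ : X → E} (hf : WeakTendsto μ f f₀)
    (hg : WeakTendsto μ g g₀) (hfm : ∀ n, MemLp (f n) 2 μ) (hgm : ∀ n, MemLp (g n) 2 μ)
    (hf₀ : MemLp f₀ 2 μ) (hg₀ : MemLp g₀ 2 μ) :
    WeakTendsto μ (fun n x => f n x - g n x) (fun x => f₀ x - g₀ x) := by
  intro w hw
  have h : ∀ {a b : X → E}, MemLp a 2 μ → MemLp b 2 μ → ∫ x, inner ℝ (a x - b x) (w x) ∂μ =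
      ∫ x, inner ℝ (a x) (w x) ∂μ - ∫ x, inner ℝ (b x) (w x) ∂μ := fun ha hb => by
    rw [← integral_sub (integrable_inner_of_memLp ha hw) (integrable_inner_of_memLp hb hw)]
    simp only [inner_sub_left]
  simp only [h (hfm _) (hgm _), h hf₀ hg₀]
  exact (hf w hw).sub (hg w hw)

lemma WeakTendsto.congr {f g : ℕ → X → E} {f₀ g₀ : X → E} (hf : WeakTendsto μ f f₀)
    (h : ∀ n, f n =ᵐ[μ] g n) (h₀ : f₀ =ᵐ[μ] g₀) : WeakTendsto μ g g₀ := by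
  intro w hw
  have e : ∀ {a b : X → E}, a =ᵐ[μ] b →
      ∫ x, inner ℝ (a x) (w x) ∂μ = ∫ x, inner ℝ (b x) (w x) ∂μ := fun hab =>
    integral_congr_ae (by filter_upwards [hab] with x hx; rw [hx])
  simpa only [e (h _), e h₀] using hf w hw

/-- Bounded sequences in `L²` of a separable measure have weakly convergent subsequences. -/
theorem exists_subseq_weakTendsto [IsSeparable μ] [CompleteSpace E]
    [TopologicalSpace.SeparableSpace E] {f : ℕ → X → E} (hf : ∀ n, MemLp (f n) 2 μ) {R : ℝ}
    (hR : ∀ n, (eLpNorm (f n) 2 μ).toReal ≤ R) :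
    ∃ f₀, MemLp f₀ 2 μ ∧ ∃ σ : ℕ → ℕ, StrictMono σ ∧ WeakTendsto μ (fun n => f (σ n)) f₀ := by
  have : Fact ((2 : ℝ≥0∞) ≠ ⊤) := ⟨by simp⟩
  let H := Lp E 2 μ
  let z : ℕ → H := fun n => (hf n).toLp (f n)
  have hz : ∀ n, ‖z n‖ ≤ R := fun n => by
    exact (Lp.norm_toLp (f n) (hf n)).trans_le (hR n)
  obtain ⟨ℓ, -, σ, hσ, hlim⟩ := WeakDual.isSeqCompact_closedBall ℝ H 0 R
    (x := fun n => StrongDual.toWeakDual (InnerProductSpace.toDual ℝ H (z n))) (fun n => by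
      simpa [Metric.mem_closedBall, dist_zero_right] using hz n)
  let f₀ : H := (InnerProductSpace.toDual ℝ H).symm (WeakDual.toStrongDual ℓ)
  refine ⟨f₀, Lp.memLp f₀, σ, hσ, fun w hw => ?_⟩
  have h1 := ((WeakDual.eval_continuous (𝕜 := ℝ) (hw.toLp w)).tendsto ℓ).comp hlim
  have h2 : ∀ n, ∫ x, inner ℝ (f (σ n) x) (w x) ∂μ = inner ℝ (z (σ n)) (hw.toLp w) :=
    fun n => integral_inner_eq_inner_toLp (hf _) hw
  have h3 : ∫ x, inner ℝ (f₀ x) (w x) ∂μ = ℓ (hw.toLp w) := by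
    rw [integral_inner_eq_inner_toLp (Lp.memLp f₀) hw, Lp.toLp_coeFn]
    exact InnerProductSpace.toDual_symm_apply
  rw [h3]
  simp only [h2]
  exact h1

end WeakConvergence

/-! ### Test functions and weak gradients -/

section TestFunctions

variable {Ω : Set E3} {ψ χ : E3 → ℝ}

lemma gradient_apply_eq (ψ : E3 → ℝ) (x : E3) (k : Fin 3) :
    gradient ψ x k = fderiv ℝ ψ x (EuclideanSpace.single k 1) := by
  rw [← inner_gradient_left, EuclideanSpace.inner_single_right]
  simp

lemma norm_gradient_eq (ψ : E3 → ℝ) (x : E3) : ‖gradient ψ x‖ = ‖fderiv ℝ ψ x‖ := by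
  simp [gradient]

namespace IsTestFunction

lemma differentiable (hψ : IsTestFunction Ω ψ) : Differentiable ℝ ψ :=
  hψ.contDiff.differentiable (by simp)

lemma continuous (hψ : IsTestFunction Ω ψ) : Continuous ψ := hψ.contDiff.continuous

lemma continuous_fderiv (hψ : IsTestFunction Ω ψ) : Continuous (fderiv ℝ ψ) :=
  hψ.contDiff.continuous_fderiv (by simp)

lemma continuous_gradient (hψ : IsTestFunction Ω ψ) : Continuous (gradient ψ) :=
  (InnerProductSpace.toDual ℝ E3).symm.continuous.comp hψ.continuous_fderiv

lemma hasCompactSupport_gradient (hψ : IsTestFunction Ω ψ) : HasCompactSupport (gradient ψ) :=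
  (hψ.hasCompactSupport.fderiv (𝕜 := ℝ)).comp_left (map_zero (InnerProductSpace.toDual ℝ E3).symm)

lemma eq_zero_of_notMem (hψ : IsTestFunction Ω ψ) {x : E3} (hx : x ∉ Ω) : ψ x = 0 :=
  image_eq_zero_of_notMem_tsupport fun h => hx (hψ.tsupport_subset h)

lemma gradient_eq_zero_of_notMem (hψ : IsTestFunction Ω ψ) {x : E3} (hx : x ∉ Ω) :
    gradient ψ x = 0 := by
  have h : fderiv ℝ ψ x = 0 := image_eq_zero_of_notMem_tsupport fun h =>
    hx (hψ.tsupport_subset (tsupport_fderiv_subset ℝ h))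
  simp [gradient, h]

lemma memLp (hψ : IsTestFunction Ω ψ) : MemLp ψ 2 (volume.restrict Ω) :=
  hψ.continuous.memLp_of_hasCompactSupport hψ.hasCompactSupport

lemma memLp_gradient (hψ : IsTestFunction Ω ψ) : MemLp (gradient ψ) 2 (volume.restrict Ω) :=
  hψ.continuous_gradient.memLp_of_hasCompactSupport hψ.hasCompactSupport_gradient

protected lemma zero (Ω : Set E3) : IsTestFunction Ω (fun _ => 0) where
  contDiff := contDiff_const
  hasCompactSupport := HasCompactSupport.zero
  tsupport_subset := by simp [tsupport, Function.support]

protected lemma add (hψ : IsTestFunction Ω ψ) (hχ : IsTestFunction Ω χ) :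
    IsTestFunction Ω (fun x => ψ x + χ x) where
  contDiff := hψ.contDiff.add hχ.contDiff
  hasCompactSupport := hψ.hasCompactSupport.add hχ.hasCompactSupport
  tsupport_subset :=
    (tsupport_add ψ χ).trans (Set.union_subset hψ.tsupport_subset hχ.tsupport_subset)

protected lemma const_mul (hψ : IsTestFunction Ω ψ) (c : ℝ) :
    IsTestFunction Ω (fun x => c * ψ x) where
  contDiff := contDiff_const.mul hψ.contDiff
  hasCompactSupport := hψ.hasCompactSupport.mul_left
  tsupport_subset := (tsupport_mul_subset_right (f := fun _ => c)).trans hψ.tsupport_subset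

lemma gradient_add (hψ : IsTestFunction Ω ψ) (hχ : IsTestFunction Ω χ) (x : E3) :
    gradient (fun x => ψ x + χ x) x = gradient ψ x + gradient χ x := by
  simp only [gradient]
  rw [fderiv_fun_add (hψ.differentiable x) (hχ.differentiable x), map_add]

lemma gradient_const_mul (hψ : IsTestFunction Ω ψ) (c : ℝ) (x : E3) :
    gradient (fun x => c * ψ x) x = c • gradient ψ x := by
  simp only [gradient]
  rw [fderiv_const_mul (hψ.differentiable x)]
  simp

protected lemma sub (hψ : IsTestFunction Ω ψ) (hχ : IsTestFunction Ω χ) :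
    IsTestFunction Ω (fun x => ψ x - χ x) := by
  convert hψ.add (hχ.const_mul (-1)) using 2
  ring

lemma gradient_sub (hψ : IsTestFunction Ω ψ) (hχ : IsTestFunction Ω χ) (x : E3) :
    gradient (fun x => ψ x - χ x) x = gradient ψ x - gradient χ x := by
  simp only [gradient]
  rw [fderiv_fun_sub (hψ.differentiable x) (hχ.differentiable x), map_sub]

/-- Integration by parts for two test functions. -/
lemma integral_mul_gradient (hψ : IsTestFunction Ω ψ) (hχ : IsTestFunction Ω χ) (k : Fin 3) :
    ∫ x in Ω, χ x * gradient ψ x k = - ∫ x in Ω, gradient χ x k * ψ x := by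
  rw [setIntegral_eq_integral_of_forall_compl_eq_zero
      (fun x hx => by rw [hχ.eq_zero_of_notMem hx, zero_mul]),
    setIntegral_eq_integral_of_forall_compl_eq_zero
      (fun x hx => by rw [hψ.eq_zero_of_notMem hx, mul_zero])]
  simp only [gradient_apply_eq]
  have hc : ∀ {ψ : E3 → ℝ}, IsTestFunction Ω ψ →
      Continuous fun x => fderiv ℝ ψ x (EuclideanSpace.single k 1) := fun h =>
    h.continuous_fderiv.clm_apply continuous_const
  refine integral_mul_fderiv_eq_neg_fderiv_mul_of_integrable ?_ ?_ ?_
    (fun x _ => hχ.differentiable x) (fun x _ => hψ.differentiable x)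
  · exact ((hc hχ).mul hψ.continuous).integrable_of_hasCompactSupport hψ.hasCompactSupport.mul_left
  · exact (hχ.continuous.mul (hc hψ)).integrable_of_hasCompactSupport hχ.hasCompactSupport.mul_right
  · exact (hχ.continuous.mul hψ.continuous).integrable_of_hasCompactSupport
      hψ.hasCompactSupport.mul_left

/-- A locally integrable function times a test function is integrable. -/
lemma integrable_mul (hψ : IsTestFunction Ω ψ) {f : E3 → ℝ}
    (hf : LocallyIntegrableOn f Ω volume) : Integrable (fun x => f x * ψ x) := by
  have h : IntegrableOn f (tsupport ψ) volume :=
    hf.integrableOn_compact_subset hψ.tsupport_subset hψ.hasCompactSupport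
  refine (integrableOn_iff_integrable_of_support_subset (s := tsupport ψ) ?_).mp
    (h.mul_continuousOn hψ.continuous.continuousOn hψ.hasCompactSupport)
  intro x hx
  exact subset_tsupport ψ fun h0 => hx (by simp [h0])

end IsTestFunction

lemma locallyIntegrableOn_coord {g : E3 → E3} (hg : LocallyIntegrableOn g Ω volume) (k : Fin 3) :
    LocallyIntegrableOn (fun x => g x k) Ω volume := by
  intro x hx
  obtain ⟨s, hs, hi⟩ := hg x hx
  exact ⟨s, hs, (EuclideanSpace.proj (𝕜 := ℝ) k).integrable_comp hi⟩

/-- Weak gradients are unique up to equality almost everywhere. -/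
lemma HasWeakGradient.ae_eq (hΩ : IsOpen Ω) {u : E3 → ℝ} {g g' : E3 → E3}
    (hg : HasWeakGradient Ω u g) (hg' : HasWeakGradient Ω u g') :
    g =ᵐ[volume.restrict Ω] g' := by
  have h : ∀ k : Fin 3, ∀ᵐ x ∂(volume.restrict Ω), g x k = g' x k := by
    intro k
    have h1 := locallyIntegrableOn_coord hg.locallyIntegrableOn_gradient k
    have h2 := locallyIntegrableOn_coord hg'.locallyIntegrableOn_gradient k
    have h3 := hΩ.ae_eq_zero_of_integral_contDiff_smul_eq_zero (h1.sub h2) (fun ψ hs hc ht => by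
      have hψ : IsTestFunction Ω ψ := ⟨hs, hc, ht⟩
      have e := (hg.integral_eq ψ hψ k).symm.trans (hg'.integral_eq ψ hψ k)
      rw [neg_inj, setIntegral_eq_integral_of_forall_compl_eq_zero
          (fun x hx => by rw [hψ.eq_zero_of_notMem hx, mul_zero]),
        setIntegral_eq_integral_of_forall_compl_eq_zero
          (fun x hx => by rw [hψ.eq_zero_of_notMem hx, mul_zero])] at e
      rw [← sub_eq_zero, ← integral_sub (hψ.integrable_mul h1) (hψ.integrable_mul h2)] at e
      rw [← e]
      refine integral_congr_ae (Eventually.of_forall fun x => ?_)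
      simp only [Pi.sub_apply, smul_eq_mul]
      ring)
    rw [ae_restrict_iff' hΩ.measurableSet]
    filter_upwards [h3] with x hx hxΩ
    exact sub_eq_zero.mp (hx hxΩ)
  filter_upwards [ae_all_iff.mpr h] with x hx
  ext k
  exact hx k

lemma hasWeakGradient_weakGradient {u : E3 → ℝ} (h : ∃ g, HasWeakGradient Ω u g) :
    HasWeakGradient Ω u (weakGradient Ω u) := by
  rw [weakGradient, dif_pos h]
  exact h.choose_spec

lemma locallyIntegrableOn_of_memLp {E : Type*} [NormedAddCommGroup E] {f : E3 → E}
    (hf : MemLp f 2 (volume.restrict Ω)) : LocallyIntegrableOn f Ω volume :=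
  locallyIntegrableOn_of_locallyIntegrable_restrict (hf.locallyIntegrable (by norm_num))

/-- The limit in `L²` of test functions whose gradients converge in `L²` belongs to `H_0^1`, and its
weak gradient is the limit of the gradients. -/
lemma memH10_of_tendsto (hΩ : IsOpen Ω) {u : E3 → ℝ} {g : E3 → E3}
    (hu : MemLp u 2 (volume.restrict Ω)) (hg : MemLp g 2 (volume.restrict Ω))
    {ψ : ℕ → E3 → ℝ} (hψ : ∀ n, IsTestFunction Ω (ψ n))
    (h1 : Tendsto (fun n => eLpNorm (fun x => ψ n x - u x) 2 (volume.restrict Ω)) atTop (𝓝 0))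
    (h2 : Tendsto (fun n => eLpNorm (fun x => gradient (ψ n) x - g x) 2 (volume.restrict Ω))
      atTop (𝓝 0)) :
    MemH10 Ω u ∧ weakGradient Ω u =ᵐ[volume.restrict Ω] g := by
  have hw : HasWeakGradient Ω u g := by
    refine ⟨locallyIntegrableOn_of_memLp hu, locallyIntegrableOn_of_memLp hg, fun χ hχ k => ?_⟩
    have t1 := weakTendsto_of_eLpNorm (fun n => (hψ n).memLp) hu h1 (fun x => gradient χ x k)
      (hχ.memLp_gradient.eval_piLp k)
    have t2 := weakTendsto_of_eLpNorm (fun n => (hψ n).memLp_gradient) hg h2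
      (fun x => χ x • EuclideanSpace.single k (1 : ℝ)) (by
        refine (hχ.continuous.smul continuous_const).memLp_of_hasCompactSupport ?_
        exact hχ.hasCompactSupport.smul_right)
    have e : ∀ (v : E3) (c : ℝ), inner ℝ v (c • EuclideanSpace.single k (1 : ℝ)) = v k * c := by
      intro v c
      rw [inner_smul_right, EuclideanSpace.inner_single_right]
      simp [mul_comm]
    simp only [e] at t2
    have e' : ∀ a b : ℝ, inner ℝ a b = a * b := fun a b => by simp [mul_comm]
    simp only [e'] at t1
    refine tendsto_nhds_unique t1 (t2.neg.congr fun n => ?_)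
    exact (hχ.integral_mul_gradient (hψ n) k).symm
  have hae := (hasWeakGradient_weakGradient ⟨g, hw⟩).ae_eq hΩ hw
  refine ⟨⟨⟨hu, ⟨g, hw⟩, hg.ae_eq hae.symm⟩, ψ, hψ, h1, h2.congr fun n => ?_⟩, hae⟩
  refine eLpNorm_congr_ae ?_
  filter_upwards [hae] with x hx
  rw [hx]

lemma IsTestFunction.memH10 (hΩ : IsOpen Ω) (hψ : IsTestFunction Ω ψ) :
    MemH10 Ω ψ ∧ weakGradient Ω ψ =ᵐ[volume.restrict Ω] gradient ψ :=
  memH10_of_tendsto hΩ hψ.memLp hψ.memLp_gradient (fun _ => hψ) (by simp) (by simp)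

/-- `H_0^1` does not see changes on null sets. -/
lemma MemH10.congr_ae (hΩ : IsOpen Ω) {u v : E3 → ℝ} (hu : MemH10 Ω u)
    (huv : u =ᵐ[volume.restrict Ω] v) :
    MemH10 Ω v ∧ weakGradient Ω v =ᵐ[volume.restrict Ω] weakGradient Ω u := by
  obtain ⟨ψ, hψ, h1, h2⟩ := hu.exists_approx
  refine memH10_of_tendsto hΩ (hu.memH1.memLp.ae_eq huv) hu.memH1.memLp_weakGradient hψ
    (h1.congr fun n => eLpNorm_congr_ae ?_) h2
  filter_upwards [huv] with x hx
  rw [hx]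

end TestFunctions

/-! ### Strong approximation of weak limits -/

section Mazur

variable {Ω : Set E3}

/-- The pairs `(ψ, ∇ψ)` of test functions and their gradients, as a subspace of `L² × L²`. -/
def testPairs (Ω : Set E3) :
    Submodule ℝ (WithLp 2 (Lp ℝ 2 (volume.restrict Ω) × Lp E3 2 (volume.restrict Ω))) where
  carrier := {f | ∃ ψ, IsTestFunction Ω ψ ∧ f.fst =ᵐ[volume.restrict Ω] ψ ∧
    f.snd =ᵐ[volume.restrict Ω] gradient ψ}
  zero_mem' := by
    refine ⟨_, .zero Ω, Lp.coeFn_zero _ _ _, ?_⟩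
    filter_upwards [Lp.coeFn_zero E3 2 (volume.restrict Ω)] with x hx
    simpa [gradient] using hx
  add_mem' := by
    rintro f g ⟨ψ, hψ, hf1, hf2⟩ ⟨χ, hχ, hg1, hg2⟩
    refine ⟨_, hψ.add hχ, ?_, ?_⟩
    · filter_upwards [Lp.coeFn_add f.fst g.fst, hf1, hg1] with x h h1 h2
      simpa [h1, h2] using h
    · filter_upwards [Lp.coeFn_add f.snd g.snd, hf2, hg2] with x h h1 h2
      rw [hψ.gradient_add hχ]
      simpa [h1, h2] using h
  smul_mem' := by
    rintro c f ⟨ψ, hψ, hf1, hf2⟩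
    refine ⟨_, hψ.const_mul c, ?_, ?_⟩
    · filter_upwards [Lp.coeFn_smul c f.fst, hf1] with x h h1
      simpa [h1] using h
    · filter_upwards [Lp.coeFn_smul c f.snd, hf2] with x h h1
      rw [hψ.gradient_const_mul]
      simpa [h1] using h

/-- If test functions and their gradients converge weakly in `L²`, then the pair of limits is also a
strong limit of such pairs: the closure of a subspace is weakly closed, being equal to its double
orthogonal complement. -/
theorem exists_tendsto_of_weakTendsto {u : E3 → ℝ} {g : E3 → E3}
    (hu : MemLp u 2 (volume.restrict Ω)) (hg : MemLp g 2 (volume.restrict Ω))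
    {ψ : ℕ → E3 → ℝ} (hψ : ∀ n, IsTestFunction Ω (ψ n))
    (h1 : WeakTendsto (volume.restrict Ω) ψ u)
    (h2 : WeakTendsto (volume.restrict Ω) (fun n => gradient (ψ n)) g) :
    ∃ χ : ℕ → E3 → ℝ, (∀ n, IsTestFunction Ω (χ n)) ∧
      Tendsto (fun n => eLpNorm (fun x => χ n x - u x) 2 (volume.restrict Ω)) atTop (𝓝 0) ∧
      Tendsto (fun n => eLpNorm (fun x => gradient (χ n) x - g x) 2 (volume.restrict Ω))
        atTop (𝓝 0) := by
  let pair : ∀ {v : E3 → ℝ} {w : E3 → E3}, MemLp v 2 (volume.restrict Ω) →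
      MemLp w 2 (volume.restrict Ω) →
      WithLp 2 (Lp ℝ 2 (volume.restrict Ω) × Lp E3 2 (volume.restrict Ω)) :=
    fun hv hw => WithLp.toLp 2 (hv.toLp _, hw.toLp _)
  have hmem : pair hu hg ∈ closure (testPairs Ω : Set (WithLp 2 (Lp ℝ 2 (volume.restrict Ω) ×
      Lp E3 2 (volume.restrict Ω)))) := by
    rw [← Submodule.topologicalClosure_coe, ← Submodule.orthogonal_orthogonal_eq_closure,
      SetLike.mem_coe, Submodule.mem_orthogonal]
    intro v hv
    have hv' := (Submodule.mem_orthogonal _ _).mp hv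
    have e : ∀ {a : E3 → ℝ} {b : E3 → E3} (ha : MemLp a 2 (volume.restrict Ω))
        (hb : MemLp b 2 (volume.restrict Ω)), inner ℝ (pair ha hb) v =
          (∫ x in Ω, inner ℝ (a x) (v.fst x)) + ∫ x in Ω, inner ℝ (b x) (v.snd x) := by
      intro a b ha hb
      rw [WithLp.prod_inner_apply, integral_inner_eq_inner_toLp ha (Lp.memLp v.fst),
        integral_inner_eq_inner_toLp hb (Lp.memLp v.snd), Lp.toLp_coeFn, Lp.toLp_coeFn]
      rfl
    have t := (h1 v.fst (Lp.memLp v.fst)).add (h2 v.snd (Lp.memLp v.snd))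
    replace t := t.congr fun n => (e (hψ n).memLp (hψ n).memLp_gradient).symm
    rw [← e hu hg] at t
    rw [real_inner_comm]
    refine tendsto_nhds_unique t (tendsto_const_nhds.congr fun n => ?_)
    exact (hv' (pair (hψ n).memLp (hψ n).memLp_gradient) ⟨ψ n, hψ n, (hψ n).memLp.coeFn_toLp,
      (hψ n).memLp_gradient.coeFn_toLp⟩).symm
  obtain ⟨f, hf, hlim⟩ := mem_closure_iff_seq_limit.mp hmem
  choose χ hχ hχ1 hχ2 using hf
  have hc := (WithLp.prod_continuous_ofLp 2 _ _).tendsto (pair hu hg) |>.comp hlim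
  have l1 := (continuous_fst.tendsto _).comp hc
  have l2 := (continuous_snd.tendsto _).comp hc
  rw [Lp.tendsto_Lp_iff_tendsto_eLpNorm'] at l1 l2
  refine ⟨χ, hχ, l1.congr fun n => eLpNorm_congr_ae ?_, l2.congr fun n => eLpNorm_congr_ae ?_⟩
  · filter_upwards [hχ1 n, hu.coeFn_toLp] with x e1 e2
    rw [← e1, ← e2]; rfl
  · filter_upwards [hχ2 n, hg.coeFn_toLp] with x e1 e2
    rw [← e1, ← e2]; rfl

end Mazur

/-! ### Compactness of the embedding into `L²` -/

section Rellich

lemma eLpNorm_two_sq {X E : Type*} [MeasurableSpace X] {μ : Measure X} [NormedAddCommGroup E]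
    (f : X → E) : eLpNorm f 2 μ ^ 2 = ∫⁻ x, ‖f x‖ₑ ^ 2 ∂μ := by
  simpa using eLpNorm_nnreal_pow_eq_lintegral (f := f) (μ := μ) (p := 2) (by simp)

lemma tendsto_eLpNorm_two_of_sq {X E : Type*} [MeasurableSpace X] {μ : Measure X}
    [NormedAddCommGroup E] {f : ℕ → X → E}
    (h : Tendsto (fun n => eLpNorm (f n) 2 μ ^ 2) atTop (𝓝 0)) :
    Tendsto (fun n => eLpNorm (f n) 2 μ) atTop (𝓝 0) := by
  have hroot := (ENNReal.continuous_rpow_const (y := (1 / 2 : ℝ))).tendsto 0 |>.comp h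
  rw [ENNReal.zero_rpow_of_pos (by norm_num)] at hroot
  refine hroot.congr fun n => ?_
  simp only [Function.comp_apply]
  rw [← ENNReal.rpow_natCast, ← ENNReal.rpow_mul]
  norm_num

lemma enorm_sq_eq_ofReal {E : Type*} [NormedAddCommGroup E] (v : E) :
    ‖v‖ₑ ^ 2 = ENNReal.ofReal (‖v‖ ^ 2) := by
  rw [← ofReal_norm, ENNReal.ofReal_pow (norm_nonneg v)]

lemma sq_integral_le {X : Type*} [MeasurableSpace X] {ν : Measure X} [IsFiniteMeasure ν]
    {F : X → ℝ} (hF : Integrable F ν) (hF2 : Integrable (fun x => F x ^ 2) ν) :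
    (∫ x, F x ∂ν) ^ 2 ≤ ν.real Set.univ * ∫ x, F x ^ 2 ∂ν := by
  set c := ν.real Set.univ with hc
  set m := ∫ x, F x ∂ν with hm
  rcases (measureReal_nonneg (μ := ν) (s := Set.univ)).eq_or_lt with h0 | h0
  · have : ν = 0 := by
      rw [eq_comm, measureReal_eq_zero_iff] at h0
      exact Measure.measure_univ_eq_zero.mp h0
    simp [hm, this]
  have e : ∫ x, (c * F x - m) ^ 2 ∂ν = c * (c * ∫ x, F x ^ 2 ∂ν - m ^ 2) := by
    have h1 : ∀ x, (c * F x - m) ^ 2 = c ^ 2 * F x ^ 2 - 2 * c * m * F x + m ^ 2 :=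
      fun x => by ring
    simp only [h1]
    rw [integral_add (f := fun x => c ^ 2 * F x ^ 2 - 2 * c * m * F x)
        ((hF2.const_mul _).sub (hF.const_mul _)) (integrable_const _),
      integral_sub (hF2.const_mul _) (hF.const_mul _), integral_const_mul, integral_const_mul,
      integral_const, ← hm, ← hc, smul_eq_mul]
    ring
  have h2 : 0 ≤ c * (c * ∫ x, F x ^ 2 ∂ν - m ^ 2) := by
    rw [← e]
    exact integral_nonneg fun x => sq_nonneg _
  linarith [(mul_nonneg_iff_of_pos_left h0).mp h2]

variable {Ω : Set E3} {ψ : E3 → ℝ}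

lemma IsTestFunction.sq_sub_le (hψ : IsTestFunction Ω ψ) (x y : E3) :
    (ψ (x + y) - ψ x) ^ 2 ≤ ∫ t in Set.Ioc (0 : ℝ) 1, (fderiv ℝ ψ (x + t • y) y) ^ 2 := by
  have hc : Continuous fun t : ℝ => fderiv ℝ ψ (x + t • y) y :=
    (hψ.continuous_fderiv.comp (by fun_prop)).clm_apply continuous_const
  have h1 : ∫ t in (0 : ℝ)..1, fderiv ℝ ψ (x + t • y) y = ψ (x + y) - ψ x := by
    rw [intervalIntegral.integral_eq_sub_of_hasDerivAt (f := fun t : ℝ => ψ (x + t • y))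
      (fun t _ => ?_) (hc.intervalIntegrable _ _)]
    · simp
    · have h2 : HasDerivAt (fun t : ℝ => x + t • y) y t := by
        simpa using ((hasDerivAt_id t).smul_const y).const_add x
      exact (hψ.differentiable _).hasFDerivAt.comp_hasDerivAt t h2
  rw [← h1, intervalIntegral.integral_of_le zero_le_one]
  have h3 := sq_integral_le (ν := volume.restrict (Set.Ioc (0 : ℝ) 1))
    (hc.integrableOn_Ioc) ((hc.pow 2).integrableOn_Ioc)
  simpa using h3

/-- Translations of a test function by `y` are `‖y‖`-close to it in `L²`, relative to the norm of
the gradient. -/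
lemma IsTestFunction.lintegral_translate_sub_le (hψ : IsTestFunction Ω ψ) (y : E3) :
    ∫⁻ x, ENNReal.ofReal ((ψ x - ψ (x + y)) ^ 2) ≤
      ENNReal.ofReal (‖y‖ ^ 2) * ∫⁻ x, ‖gradient ψ x‖ₑ ^ 2 := by
  have hg : Measurable fun x => ‖gradient ψ x‖ₑ ^ 2 :=
    (hψ.continuous_gradient.measurable.enorm).pow_const 2
  have h1 : ∀ x, ENNReal.ofReal ((ψ x - ψ (x + y)) ^ 2) ≤
      ∫⁻ t in Set.Ioc (0 : ℝ) 1, ENNReal.ofReal (‖y‖ ^ 2) * ‖gradient ψ (x + t • y)‖ₑ ^ 2 := by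
    intro x
    have hc : Continuous fun t : ℝ => fderiv ℝ ψ (x + t • y) y :=
      (hψ.continuous_fderiv.comp (by fun_prop)).clm_apply continuous_const
    rw [sub_sq_comm]
    refine (ENNReal.ofReal_le_ofReal (hψ.sq_sub_le x y)).trans ?_
    have hi : IntegrableOn (fun t : ℝ => (fderiv ℝ ψ (x + t • y) y) ^ 2) (Set.Ioc 0 1) :=
      (hc.pow 2).integrableOn_Ioc
    rw [ofReal_integral_eq_lintegral_ofReal hi
      (Eventually.of_forall fun t => sq_nonneg _)]
    refine lintegral_mono fun t => ?_
    rw [enorm_sq_eq_ofReal, ← ENNReal.ofReal_mul (sq_nonneg _), ← mul_pow, norm_gradient_eq]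
    refine ENNReal.ofReal_le_ofReal ?_
    rw [← sq_abs]
    refine pow_le_pow_left₀ (abs_nonneg _) ?_ 2
    rw [mul_comm]
    exact (fderiv ℝ ψ (x + t • y)).le_opNorm y
  calc ∫⁻ x, ENNReal.ofReal ((ψ x - ψ (x + y)) ^ 2)
      ≤ ∫⁻ x, ∫⁻ t in Set.Ioc (0 : ℝ) 1,
          ENNReal.ofReal (‖y‖ ^ 2) * ‖gradient ψ (x + t • y)‖ₑ ^ 2 := lintegral_mono h1
    _ = ∫⁻ t in Set.Ioc (0 : ℝ) 1, ∫⁻ x,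
          ENNReal.ofReal (‖y‖ ^ 2) * ‖gradient ψ (x + t • y)‖ₑ ^ 2 := by
        refine lintegral_lintegral_swap ?_
        refine Measurable.aemeasurable (Measurable.const_mul ?_ _)
        exact hg.comp (f := fun q : E3 × ℝ => q.1 + q.2 • y) (by fun_prop)
    _ = ∫⁻ t in Set.Ioc (0 : ℝ) 1, ENNReal.ofReal (‖y‖ ^ 2) * ∫⁻ x, ‖gradient ψ x‖ₑ ^ 2 := by
        refine lintegral_congr fun t => ?_
        rw [lintegral_const_mul' _ _ ENNReal.ofReal_ne_top,
          lintegral_add_right_eq_self (fun x => ‖gradient ψ x‖ₑ ^ 2)]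
    _ = ENNReal.ofReal (‖y‖ ^ 2) * ∫⁻ x, ‖gradient ψ x‖ₑ ^ 2 := by simp

/-- The integral of `ψ` over the ball of radius `δ` with centre `x`. -/
def ballIntegral (δ : ℝ) (ψ : E3 → ℝ) (x : E3) : ℝ :=
  ∫ y in Metric.ball (0 : E3) δ, ψ (x + y)

/-- The volume of a ball of radius `δ`. -/
def ballVolume (δ : ℝ) : ℝ := volume.real (Metric.ball (0 : E3) δ)

lemma ballVolume_pos {δ : ℝ} (hδ : 0 < δ) : 0 < ballVolume δ :=
  ENNReal.toReal_pos (Metric.measure_ball_pos _ _ hδ).ne' measure_ball_lt_top.ne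

lemma IsTestFunction.measurable_ballIntegral (hψ : IsTestFunction Ω ψ) (δ : ℝ) :
    Measurable (ballIntegral δ ψ) := by
  have h : StronglyMeasurable (fun q : E3 × E3 => ψ (q.1 + q.2)) :=
    (hψ.continuous.comp (by fun_prop : Continuous fun q : E3 × E3 => q.1 + q.2)).stronglyMeasurable
  exact (h.integral_prod_right (ν := volume.restrict (Metric.ball (0 : E3) δ))).measurable

/-- The distance in `L²` of a test function to its averages over balls of radius `δ` is at most `δ`
times the norm of the gradient. -/
lemma IsTestFunction.lintegral_sub_ballAverage_le (hψ : IsTestFunction Ω ψ) {δ : ℝ} (hδ : 0 < δ) :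
    ∫⁻ x, ENNReal.ofReal ((ψ x - (ballVolume δ)⁻¹ * ballIntegral δ ψ x) ^ 2) ≤
      ENNReal.ofReal (δ ^ 2) * ∫⁻ x, ‖gradient ψ x‖ₑ ^ 2 := by
  set D := ∫⁻ x, ‖gradient ψ x‖ₑ ^ 2 with hD
  set c := ballVolume δ with hcdef
  set B := Metric.ball (0 : E3) δ with hB
  have hc : 0 < c := ballVolume_pos hδ
  have : IsFiniteMeasure (volume.restrict B) := ⟨by
    rw [Measure.restrict_apply_univ]; exact measure_ball_lt_top⟩
  have hint : ∀ (f : E3 → ℝ), Continuous f → IntegrableOn f B := fun f hf =>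
    (hf.continuousOn.integrableOn_compact (isCompact_closedBall (0 : E3) δ)).mono_set
      Metric.ball_subset_closedBall
  have hcont : ∀ x, Continuous fun y => ψ x - ψ (x + y) := fun x =>
    continuous_const.sub (hψ.continuous.comp (continuous_const_add x))
  have h1 : ∀ x, ENNReal.ofReal ((ψ x - c⁻¹ * ballIntegral δ ψ x) ^ 2) ≤
      ENNReal.ofReal c⁻¹ * ∫⁻ y in B, ENNReal.ofReal ((ψ x - ψ (x + y)) ^ 2) := by
    intro x
    have e : ∫ y in B, (ψ x - ψ (x + y)) = c * ψ x - ballIntegral δ ψ x := by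
      rw [integral_sub (hint _ continuous_const) (g := fun y => ψ (x + y))
        (hint _ (hψ.continuous.comp (continuous_const_add x))), setIntegral_const, smul_eq_mul]
      rfl
    have h2 := sq_integral_le (hint _ (hcont x)) (hint _ ((hcont x).pow 2))
    rw [e, measureReal_restrict_apply_univ] at h2
    rw [← ofReal_integral_eq_lintegral_ofReal (f := fun y => (ψ x - ψ (x + y)) ^ 2)
      (hint _ ((hcont x).pow 2))
      (Eventually.of_forall fun t => sq_nonneg _), ← ENNReal.ofReal_mul (inv_nonneg.mpr hc.le)]
    refine ENNReal.ofReal_le_ofReal ?_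
    have e2 : ψ x - c⁻¹ * ballIntegral δ ψ x = c⁻¹ * (c * ψ x - ballIntegral δ ψ x) := by
      field_simp
    rw [e2, mul_pow]
    calc c⁻¹ ^ 2 * (c * ψ x - ballIntegral δ ψ x) ^ 2
        ≤ c⁻¹ ^ 2 * (c * ∫ y in B, (ψ x - ψ (x + y)) ^ 2) :=
          mul_le_mul_of_nonneg_left h2 (sq_nonneg _)
      _ = c⁻¹ * ∫ y in B, (ψ x - ψ (x + y)) ^ 2 := by field_simp
  have hm : Measurable fun q : E3 × E3 => ENNReal.ofReal ((ψ q.1 - ψ (q.1 + q.2)) ^ 2) := by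
    have : Continuous fun q : E3 × E3 => (ψ q.1 - ψ (q.1 + q.2)) ^ 2 :=
      ((hψ.continuous.comp continuous_fst).sub
        (hψ.continuous.comp (by fun_prop : Continuous fun q : E3 × E3 => q.1 + q.2))).pow 2
    exact this.measurable.ennreal_ofReal
  calc ∫⁻ x, ENNReal.ofReal ((ψ x - c⁻¹ * ballIntegral δ ψ x) ^ 2)
      ≤ ∫⁻ x, ENNReal.ofReal c⁻¹ * ∫⁻ y in B, ENNReal.ofReal ((ψ x - ψ (x + y)) ^ 2) :=
        lintegral_mono h1
    _ = ENNReal.ofReal c⁻¹ * ∫⁻ y in B, ∫⁻ x, ENNReal.ofReal ((ψ x - ψ (x + y)) ^ 2) := by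
        rw [lintegral_const_mul _ (hm.lintegral_prod_right'),
          lintegral_lintegral_swap hm.aemeasurable]
    _ ≤ ENNReal.ofReal c⁻¹ * ∫⁻ y in B, ENNReal.ofReal (δ ^ 2) * D := by
        refine mul_le_mul_right ?_ _
        refine setLIntegral_mono measurable_const fun y hy => ?_
        refine (hψ.lintegral_translate_sub_le y).trans ?_
        gcongr
        exact (mem_ball_zero_iff.mp hy).le
    _ = ENNReal.ofReal (δ ^ 2) * D := by
        rw [setLIntegral_const, mul_comm (ENNReal.ofReal (δ ^ 2) * D), ← mul_assoc,
          show volume B = ENNReal.ofReal c from (ENNReal.ofReal_toReal measure_ball_lt_top.ne).symm,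
          ← ENNReal.ofReal_mul (inv_nonneg.mpr hc.le), inv_mul_cancel₀ hc.ne', ENNReal.ofReal_one,
          one_mul]

lemma IsTestFunction.ballIntegral_eq (hψ : IsTestFunction Ω ψ) (δ : ℝ) (x : E3) :
    ballIntegral δ ψ x =
      ∫ y in Ω, inner ℝ (ψ y) ((Metric.ball x δ).indicator (fun _ => (1 : ℝ)) y) := by
  rw [setIntegral_eq_integral_of_forall_compl_eq_zero
    (fun y hy => by rw [hψ.eq_zero_of_notMem hy, inner_zero_left])]
  rw [ballIntegral, ← integral_indicator Metric.isOpen_ball.measurableSet,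
    ← integral_add_left_eq_self (fun y => inner ℝ (ψ y) ((Metric.ball x δ).indicator _ y)) x]
  refine integral_congr_ae (Eventually.of_forall fun y => ?_)
  by_cases h : y ∈ Metric.ball (0 : E3) δ
  · have h' : x + y ∈ Metric.ball x δ := by simpa using h
    simp [Set.indicator_of_mem h, Set.indicator_of_mem h']
  · have h' : x + y ∉ Metric.ball x δ := by simpa using h
    simp [Set.indicator_of_notMem h, Set.indicator_of_notMem h']

/-- **Rellich's theorem** for test functions in a bounded set: weak convergence to `0` in `L²`
together with a bound on the gradients implies strong convergence. The averages over balls of a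
fixed radius `δ` converge pointwise and boundedly, and the error of averaging is of order `δ`. -/
theorem tendsto_eLpNorm_zero_of_weakTendsto (hΩ : Bornology.IsBounded Ω) {d : ℕ → E3 → ℝ}
    (hd : ∀ n, IsTestFunction Ω (d n)) (hw : WeakTendsto (volume.restrict Ω) d (fun _ => 0))
    {R : ℝ} (hR : ∀ n, (eLpNorm (d n) 2 (volume.restrict Ω)).toReal ≤ R) {G : ℝ≥0∞} (hG : G ≠ ⊤)
    (hdG : ∀ n, ∫⁻ x in Ω, ‖gradient (d n) x‖ₑ ^ 2 ≤ G) :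
    Tendsto (fun n => eLpNorm (d n) 2 (volume.restrict Ω)) atTop (𝓝 0) := by
  have : IsFiniteMeasure (volume.restrict Ω) := ⟨by
    rw [Measure.restrict_apply_univ]; exact hΩ.measure_lt_top⟩
  have hone : ∀ (x : E3) (δ : ℝ), MemLp ((Metric.ball x δ).indicator (fun _ => (1 : ℝ))) 2
      (volume.restrict Ω) := fun x δ => (memLp_const 1).indicator Metric.isOpen_ball.measurableSet
  -- the averages converge to zero
  have hA : ∀ δ : ℝ, Tendsto (fun n => ∫⁻ x in Ω,
      ENNReal.ofReal (((ballVolume δ)⁻¹ * ballIntegral δ (d n) x) ^ 2)) atTop (𝓝 0) := by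
    intro δ
    set b := R * (eLpNorm (fun _ : E3 => (1 : ℝ)) 2 (volume.restrict Ω)).toReal with hb
    have hR0 : 0 ≤ R := ENNReal.toReal_nonneg.trans (hR 0)
    have hbound : ∀ n x, |ballIntegral δ (d n) x| ≤ b := by
      intro n x
      rw [(hd n).ballIntegral_eq]
      refine (abs_integral_inner_le (hd n).memLp (hone x δ)).trans ?_
      refine mul_le_mul (hR n) ?_ ENNReal.toReal_nonneg hR0
      exact ENNReal.toReal_mono (memLp_const 1).eLpNorm_ne_top (eLpNorm_indicator_le _)
    have hlim : ∀ x, Tendsto (fun n => ballIntegral δ (d n) x) atTop (𝓝 0) := by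
      intro x
      simpa only [(hd _).ballIntegral_eq, inner_zero_left, integral_zero] using hw _ (hone x δ)
    have h := tendsto_lintegral_of_dominated_convergence (μ := volume.restrict Ω)
      (F := fun n x => ENNReal.ofReal (((ballVolume δ)⁻¹ * ballIntegral δ (d n) x) ^ 2))
      (f := fun _ => 0) (fun _ => ENNReal.ofReal (((ballVolume δ)⁻¹ * b) ^ 2))
      (fun n => (((hd n).measurable_ballIntegral δ).const_mul _ |>.pow_const 2).ennreal_ofReal)
      (fun n => Eventually.of_forall fun x => ENNReal.ofReal_le_ofReal (by
        rw [mul_pow, mul_pow, ← sq_abs (ballIntegral δ (d n) x)]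
        exact mul_le_mul_of_nonneg_left (pow_le_pow_left₀ (abs_nonneg _) (hbound n x) 2)
          (sq_nonneg _)))
      (by rw [lintegral_const]; exact ENNReal.mul_ne_top ENNReal.ofReal_ne_top (measure_ne_top _ _))
      (Eventually.of_forall fun x => by
        have := ((hlim x).const_mul (ballVolume δ)⁻¹).pow 2
        simpa using (ENNReal.tendsto_ofReal this))
    simpa using h
  have hmain : ∀ δ : ℝ, 0 < δ → ∀ n, eLpNorm (d n) 2 (volume.restrict Ω) ^ 2 ≤
      2 * (ENNReal.ofReal (δ ^ 2) * G) + 2 * ∫⁻ x in Ω,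
        ENNReal.ofReal (((ballVolume δ)⁻¹ * ballIntegral δ (d n) x) ^ 2) := by
    intro δ hδ n
    have hgrad : ∫⁻ x, ‖gradient (d n) x‖ₑ ^ 2 ≤ G := by
      refine le_trans (le_of_eq ?_) (hdG n)
      refine (setLIntegral_eq_of_support_subset ?_).symm
      intro x hx
      by_contra hxΩ
      exact hx (by simp [(hd n).gradient_eq_zero_of_notMem hxΩ])
    have hmeas : Measurable fun x =>
        ENNReal.ofReal (((ballVolume δ)⁻¹ * ballIntegral δ (d n) x) ^ 2) :=
      (((hd n).measurable_ballIntegral δ).const_mul _ |>.pow_const 2).ennreal_ofReal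
    rw [eLpNorm_two_sq]
    calc ∫⁻ x in Ω, ‖d n x‖ₑ ^ 2
        ≤ ∫⁻ x in Ω, (2 * ENNReal.ofReal
            ((d n x - (ballVolume δ)⁻¹ * ballIntegral δ (d n) x) ^ 2) +
            2 * ENNReal.ofReal (((ballVolume δ)⁻¹ * ballIntegral δ (d n) x) ^ 2)) := by
          refine lintegral_mono fun x => ?_
          rw [enorm_sq_eq_ofReal, ← ENNReal.ofReal_ofNat, ← ENNReal.ofReal_mul (by norm_num),
            ← ENNReal.ofReal_mul (by norm_num),
            ← ENNReal.ofReal_add (by positivity) (by positivity)]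
          refine ENNReal.ofReal_le_ofReal ?_
          rw [Real.norm_eq_abs, sq_abs]
          nlinarith [sq_nonneg (d n x - 2 * ((ballVolume δ)⁻¹ * ballIntegral δ (d n) x))]
      _ = 2 * (∫⁻ x in Ω, ENNReal.ofReal
            ((d n x - (ballVolume δ)⁻¹ * ballIntegral δ (d n) x) ^ 2)) + 2 * ∫⁻ x in Ω,
            ENNReal.ofReal (((ballVolume δ)⁻¹ * ballIntegral δ (d n) x) ^ 2) := by
          rw [lintegral_add_right _ (hmeas.const_mul 2), lintegral_const_mul _ hmeas,
            lintegral_const_mul' _ _ (by simp)]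
      _ ≤ _ := by
          refine add_le_add_left (mul_le_mul_right ?_ _) _
          exact (setLIntegral_le_lintegral _ _).trans
            (((hd n).lintegral_sub_ballAverage_le hδ).trans (by gcongr))
  have hsq : Tendsto (fun n => eLpNorm (d n) 2 (volume.restrict Ω) ^ 2) atTop (𝓝 0) := by
    rw [ENNReal.tendsto_nhds_zero]
    intro ε hε
    have hδ0 : Tendsto (fun δ : ℝ => 2 * (ENNReal.ofReal (δ ^ 2) * G)) (𝓝[>] 0) (𝓝 0) := by
      have h1 : Tendsto (fun δ : ℝ => ENNReal.ofReal (δ ^ 2)) (𝓝 0) (𝓝 0) := by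
        have : Continuous fun δ : ℝ => ENNReal.ofReal (δ ^ 2) :=
          ENNReal.continuous_ofReal.comp (continuous_pow 2)
        simpa using this.tendsto 0
      have h2 := ENNReal.Tendsto.const_mul (a := 2)
        (ENNReal.Tendsto.mul_const (b := G) h1 (Or.inr hG)) (Or.inr (by simp))
      simp only [zero_mul, mul_zero] at h2
      exact h2.mono_left nhdsWithin_le_nhds
    have hε2 : 0 < ε / 2 := ENNReal.half_pos hε.ne'
    obtain ⟨δ, hδ1, hδ⟩ :=
      (((ENNReal.tendsto_nhds_zero.mp hδ0) _ hε2).and self_mem_nhdsWithin).exists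
    have h2 : Tendsto (fun n => 2 * ∫⁻ x in Ω,
        ENNReal.ofReal (((ballVolume δ)⁻¹ * ballIntegral δ (d n) x) ^ 2)) atTop (𝓝 0) := by
      simpa using ENNReal.Tendsto.const_mul (a := 2) (hA δ) (Or.inr (by simp))
    filter_upwards [(ENNReal.tendsto_nhds_zero.mp h2) _ hε2] with n hn
    calc _ ≤ _ := hmain δ hδ n
      _ ≤ ε / 2 + ε / 2 := add_le_add hδ1 hn
      _ = ε := ENNReal.add_halves ε
  exact tendsto_eLpNorm_two_of_sq hsq

end Rellich

section H10Compactness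

variable {Ω : Set E3}

/-- The mode of convergence in which bounded sequences in `H_0^1` are compact: strongly in `L²` and
almost everywhere, with weakly convergent gradients. -/
structure H10Tendsto (Ω : Set E3) (u : ℕ → E3 → ℝ) (v : E3 → ℝ) : Prop where
  memH10 : MemH10 Ω v
  tendsto_eLpNorm :
    Tendsto (fun n => eLpNorm (fun x => u n x - v x) 2 (volume.restrict Ω)) atTop (𝓝 0)
  tendsto_ae : ∀ᵐ x ∂(volume.restrict Ω), Tendsto (fun n => u n x) atTop (𝓝 (v x))
  weakTendsto_gradient :
    WeakTendsto (volume.restrict Ω) (fun n => weakGradient Ω (u n)) (weakGradient Ω v)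

lemma H10Tendsto.comp_strictMono {u : ℕ → E3 → ℝ} {v : E3 → ℝ} (h : H10Tendsto Ω u v)
    {σ : ℕ → ℕ} (hσ : StrictMono σ) : H10Tendsto Ω (fun n => u (σ n)) v where
  memH10 := h.memH10
  tendsto_eLpNorm := h.tendsto_eLpNorm.comp hσ.tendsto_atTop
  tendsto_ae := by
    filter_upwards [h.tendsto_ae] with x hx
    exact hx.comp hσ.tendsto_atTop
  weakTendsto_gradient := h.weakTendsto_gradient.comp_strictMono hσ

lemma eLpNorm_sub_le_add {X E : Type*} [MeasurableSpace X] {μ : Measure X} [NormedAddCommGroup E]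
    {a b c : X → E} (ha : MemLp a 2 μ) (hb : MemLp b 2 μ) (hc : MemLp c 2 μ) :
    eLpNorm (fun x => a x - c x) 2 μ ≤
      eLpNorm (fun x => a x - b x) 2 μ + eLpNorm (fun x => b x - c x) 2 μ := by
  have h : (fun x => a x - c x) = (fun x => a x - b x) + (fun x => b x - c x) := by
    ext x; simp
  rw [h]
  exact eLpNorm_add_le (ha.sub hb).1 (hb.sub hc).1 (by norm_num)

lemma eLpNorm_le_sub_add {X E : Type*} [MeasurableSpace X] {μ : Measure X} [NormedAddCommGroup E]
    {a b : X → E} (ha : MemLp a 2 μ) (hb : MemLp b 2 μ) :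
    eLpNorm a 2 μ ≤ eLpNorm (fun x => a x - b x) 2 μ + eLpNorm b 2 μ := by
  have h : a = (fun x => a x - b x) + b := by
    ext x; simp
  conv_lhs => rw [h]
  exact eLpNorm_add_le (ha.sub hb).1 hb.1 (by norm_num)

/-- Bounded sequences in `H_0^1` of a bounded open set have convergent subsequences. -/
theorem exists_subseq_H10Tendsto (hΩ : IsOpen Ω) (hb : Bornology.IsBounded Ω) {u : ℕ → E3 → ℝ}
    (hu : ∀ n, MemH10 Ω (u n)) {R : ℝ≥0∞} (hR : R ≠ ⊤)
    (hu1 : ∀ n, eLpNorm (u n) 2 (volume.restrict Ω) ≤ R)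
    (hu2 : ∀ n, eLpNorm (weakGradient Ω (u n)) 2 (volume.restrict Ω) ≤ R) :
    ∃ v, ∃ σ : ℕ → ℕ, StrictMono σ ∧ H10Tendsto Ω (fun n => u (σ n)) v := by
  set μ := volume.restrict Ω with hμ
  have hum : ∀ n, MemLp (u n) 2 μ := fun n => (hu n).memH1.memLp
  have hgm : ∀ n, MemLp (weakGradient Ω (u n)) 2 μ := fun n => (hu n).memH1.memLp_weakGradient
  -- replace `u n` by a test function up to an error that tends to zero
  have hex : ∀ n : ℕ, ∃ ψ, IsTestFunction Ω ψ ∧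
      eLpNorm (fun x => ψ x - u n x) 2 μ ≤ ((n : ℝ≥0∞) + 1)⁻¹ ∧
      eLpNorm (fun x => gradient ψ x - weakGradient Ω (u n) x) 2 μ ≤ ((n : ℝ≥0∞) + 1)⁻¹ := by
    intro n
    obtain ⟨ψ, hψ, h1, h2⟩ := (hu n).exists_approx
    have hpos : (0 : ℝ≥0∞) < ((n : ℝ≥0∞) + 1)⁻¹ := by
      rw [ENNReal.inv_pos]
      exact ENNReal.add_ne_top.mpr ⟨ENNReal.natCast_ne_top n, ENNReal.one_ne_top⟩
    obtain ⟨k, hk1, hk2⟩ := ((ENNReal.tendsto_nhds_zero.mp h1 _ hpos).and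
      (ENNReal.tendsto_nhds_zero.mp h2 _ hpos)).exists
    exact ⟨ψ k, hψ k, hk1, hk2⟩
  choose ψ hψ hψ1 hψ2 using hex
  have hinv : Tendsto (fun n : ℕ => ((n : ℝ≥0∞) + 1)⁻¹) atTop (𝓝 0) := by
    have := (tendsto_add_atTop_iff_nat 1).mpr ENNReal.tendsto_inv_nat_nhds_zero
    simpa using this
  have hinv1 : ∀ n : ℕ, ((n : ℝ≥0∞) + 1)⁻¹ ≤ 1 := fun n => by
    rw [ENNReal.inv_le_one]; exact le_add_self
  have hR1 : R + 1 ≠ ⊤ := ENNReal.add_ne_top.mpr ⟨hR, ENNReal.one_ne_top⟩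
  have hψR1 : ∀ n, eLpNorm (ψ n) 2 μ ≤ R + 1 := fun n =>
    (eLpNorm_le_sub_add (hψ n).memLp (hum n)).trans (by
      rw [add_comm]; exact add_le_add (hu1 n) ((hψ1 n).trans (hinv1 n)))
  have hψR2 : ∀ n, eLpNorm (gradient (ψ n)) 2 μ ≤ R + 1 := fun n =>
    (eLpNorm_le_sub_add (hψ n).memLp_gradient (hgm n)).trans (by
      rw [add_comm]; exact add_le_add (hu2 n) ((hψ2 n).trans (hinv1 n)))
  have hz : MemLp (fun _ : E3 => (0 : E3)) 2 μ := MemLp.zero'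
  -- weak limits of the functions and of the gradients
  obtain ⟨v, hv, σ₁, hσ₁, hw1⟩ := exists_subseq_weakTendsto (fun n => (hψ n).memLp (Ω := Ω))
    (fun n => ENNReal.toReal_mono hR1 (hψR1 n))
  obtain ⟨g, hg, σ₂, hσ₂, hw2⟩ := exists_subseq_weakTendsto
    (fun n => (hψ (σ₁ n)).memLp_gradient (Ω := Ω))
    (fun n => ENNReal.toReal_mono hR1 (hψR2 (σ₁ n)))
  set τ := fun n => σ₁ (σ₂ n) with hτ
  have hτm : StrictMono τ := hσ₁.comp hσ₂
  replace hw1 : WeakTendsto μ (fun n => ψ (τ n)) v := hw1.comp_strictMono hσ₂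
  replace hw2 : WeakTendsto μ (fun n => gradient (ψ (τ n))) g := hw2
  obtain ⟨χ₀, hχ₀, hχ₀1, hχ₀2⟩ :=
    exists_tendsto_of_weakTendsto hv hg (fun n => hψ (τ n)) hw1 hw2
  obtain ⟨hv10, hvg⟩ := memH10_of_tendsto hΩ hv hg hχ₀ hχ₀1 hχ₀2
  obtain ⟨N, hN⟩ := eventually_atTop.mp ((ENNReal.tendsto_nhds_zero.mp hχ₀1 1 one_pos).and
    (ENNReal.tendsto_nhds_zero.mp hχ₀2 1 one_pos))
  set χ := fun n => χ₀ (n + N) with hχdef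
  have hχ : ∀ n, IsTestFunction Ω (χ n) := fun n => hχ₀ _
  have hχ1 : Tendsto (fun n => eLpNorm (fun x => χ n x - v x) 2 μ) atTop (𝓝 0) :=
    (tendsto_add_atTop_iff_nat N).mpr hχ₀1
  have hχR1 : ∀ n, eLpNorm (χ n) 2 μ ≤ 1 + eLpNorm v 2 μ := fun n =>
    (eLpNorm_le_sub_add (hχ n).memLp hv).trans
      (add_le_add_left (hN _ (Nat.le_add_left N n)).1 _)
  have hχR2 : ∀ n, eLpNorm (gradient (χ n)) 2 μ ≤ 1 + eLpNorm g 2 μ := fun n =>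
    (eLpNorm_le_sub_add (hχ n).memLp_gradient hg).trans
      (add_le_add_left (hN _ (Nat.le_add_left N n)).2 _)
  -- Rellich's theorem, for the differences of the two sequences of test functions
  have hd : Tendsto (fun n => eLpNorm (fun x => ψ (τ n) x - χ n x) 2 μ) atTop (𝓝 0) := by
    have hB1 : R + 1 + (1 + eLpNorm v 2 μ) ≠ ⊤ := by finiteness [hv.eLpNorm_ne_top]
    have hB2 : R + 1 + (1 + eLpNorm g 2 μ) ≠ ⊤ := by finiteness [hg.eLpNorm_ne_top]
    refine tendsto_eLpNorm_zero_of_weakTendsto hb (fun n => (hψ (τ n)).sub (hχ n)) ?_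
      (R := (R + 1 + (1 + eLpNorm v 2 μ)).toReal) (fun n => ENNReal.toReal_mono hB1 ?_)
      (G := (R + 1 + (1 + eLpNorm g 2 μ)) ^ 2) (ENNReal.pow_ne_top hB2) (fun n => ?_)
    · exact (hw1.sub (weakTendsto_of_eLpNorm (fun n => (hχ n).memLp) hv hχ1)
        (fun n => (hψ (τ n)).memLp) (fun n => (hχ n).memLp) hv hv).congr
        (fun n => EventuallyEq.rfl) (Eventually.of_forall fun x => sub_self _)
    · exact (eLpNorm_sub_le (hψ (τ n)).memLp.1 (hχ n).memLp.1 (by norm_num)).trans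
        (add_le_add (hψR1 _) (hχR1 n))
    · rw [← eLpNorm_two_sq]
      refine pow_le_pow_left' ?_ 2
      have e : gradient (fun x => ψ (τ n) x - χ n x) = gradient (ψ (τ n)) - gradient (χ n) :=
        funext fun x => (hψ (τ n)).gradient_sub (hχ n) x
      rw [e]
      exact (eLpNorm_sub_le (hψ (τ n)).memLp_gradient.1 (hχ n).memLp_gradient.1
        (by norm_num)).trans (add_le_add (hψR2 _) (hχR2 n))
  have hψu : Tendsto (fun n => eLpNorm (fun x => u (τ n) x - ψ (τ n) x) 2 μ) atTop (𝓝 0) := by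
    have h0 : Tendsto (fun n => eLpNorm (fun x => ψ (τ n) x - u (τ n) x) 2 μ) atTop (𝓝 0) :=
      tendsto_of_tendsto_of_tendsto_of_le_of_le tendsto_const_nhds
        (hinv.comp hτm.tendsto_atTop) (fun _ => bot_le) (fun n => hψ1 (τ n))
    exact h0.congr fun n => eLpNorm_sub_comm (ψ (τ n)) (u (τ n)) 2 μ
  have hL2 : Tendsto (fun n => eLpNorm (fun x => u (τ n) x - v x) 2 μ) atTop (𝓝 0) := by
    have h0 := hψu.add (hd.add hχ1)
    simp only [add_zero] at h0
    refine tendsto_of_tendsto_of_tendsto_of_le_of_le tendsto_const_nhds h0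
      (fun _ => bot_le) (fun n => ?_)
    refine (eLpNorm_sub_le_add (hum _) (hψ (τ n)).memLp hv).trans (add_le_add_right ?_ _)
    exact eLpNorm_sub_le_add (hψ (τ n)).memLp (hχ n).memLp hv
  have hgw : WeakTendsto μ (fun n => weakGradient Ω (u (τ n))) (weakGradient Ω v) := by
    have h0 : WeakTendsto μ (fun n x => gradient (ψ (τ n)) x - weakGradient Ω (u (τ n)) x)
        (fun _ => 0) := by
      refine weakTendsto_of_eLpNorm (fun n => (hψ (τ n)).memLp_gradient.sub (hgm _))
        hz ?_
      simp only [sub_zero]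
      exact tendsto_of_tendsto_of_tendsto_of_le_of_le tendsto_const_nhds
        (hinv.comp hτm.tendsto_atTop) (fun _ => bot_le) (fun n => hψ2 (τ n))
    refine (hw2.sub h0 (fun n => (hψ (τ n)).memLp_gradient)
      (fun n => (hψ (τ n)).memLp_gradient.sub (hgm _)) hg hz).congr
      (fun n => Eventually.of_forall fun x => ?_) ?_
    · simp
    · filter_upwards [hvg] with x hx
      simp [hx]
  obtain ⟨ρ, hρ, hae⟩ := (tendstoInMeasure_of_tendsto_eLpNorm (two_ne_zero)
    (fun n => (hum (τ n)).1) hv.1 hL2).exists_seq_tendsto_ae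
  exact ⟨v, fun n => τ (ρ n), hτm.comp hρ, hv10, hL2.comp hρ.tendsto_atTop, hae,
    hgw.comp_strictMono hρ⟩

/-- Finitely many bounded sequences in `H_0^1` converge along a common subsequence. -/
theorem exists_subseq_forall_H10Tendsto {ι : Type*} [Finite ι] (hΩ : IsOpen Ω)
    (hb : Bornology.IsBounded Ω) {u : ι → ℕ → E3 → ℝ} (hu : ∀ i n, MemH10 Ω (u i n)) {R : ℝ≥0∞}
    (hR : R ≠ ⊤) (hu1 : ∀ i n, eLpNorm (u i n) 2 (volume.restrict Ω) ≤ R)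
    (hu2 : ∀ i n, eLpNorm (weakGradient Ω (u i n)) 2 (volume.restrict Ω) ≤ R) :
    ∃ σ : ℕ → ℕ, StrictMono σ ∧ ∀ i, ∃ v, H10Tendsto Ω (fun n => u i (σ n)) v := by
  classical
  cases nonempty_fintype ι
  suffices h : ∀ s : Finset ι, ∃ σ : ℕ → ℕ, StrictMono σ ∧
      ∀ i ∈ s, ∃ v, H10Tendsto Ω (fun n => u i (σ n)) v by
    obtain ⟨σ, hσ, h⟩ := h Finset.univ
    exact ⟨σ, hσ, fun i => h i (Finset.mem_univ i)⟩
  intro s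
  induction s using Finset.induction_on with
  | empty => exact ⟨id, strictMono_id, by simp⟩
  | insert i s _ ih =>
    obtain ⟨σ, hσ, h⟩ := ih
    obtain ⟨v, τ, hτ, hv⟩ := exists_subseq_H10Tendsto hΩ hb (fun n => hu i (σ n)) hR
      (fun n => hu1 i (σ n)) (fun n => hu2 i (σ n))
    refine ⟨fun n => σ (τ n), hσ.comp hτ, fun j hj => ?_⟩
    rcases Finset.mem_insert.mp hj with rfl | hj
    · exact ⟨v, hv⟩
    · obtain ⟨w, hw⟩ := h j hj
      exact ⟨w, hw.comp_strictMono hτ⟩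

end H10Compactness

/-! ### Lower semicontinuity -/

section LowerSemicontinuity

variable {X E F : Type*} [MeasurableSpace X] {μ : Measure X}
  [NormedAddCommGroup E] [InnerProductSpace ℝ E] [CompleteSpace E]
  [NormedAddCommGroup F] [InnerProductSpace ℝ F] [CompleteSpace F]

lemma ofReal_integral_le_lintegral {f : X → ℝ} (hf : Integrable f μ) :
    ENNReal.ofReal (∫ x, f x ∂μ) ≤ ∫⁻ x, ENNReal.ofReal (f x) ∂μ := by
  rw [integral_eq_lintegral_pos_part_sub_lintegral_neg_part hf]
  refine (ENNReal.ofReal_le_ofReal (sub_le_self _ ENNReal.toReal_nonneg)).trans ?_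
  exact ENNReal.ofReal_toReal_le

/-- The cutoff factor `1 / (1 + c t)`, for `c > 0` and `t ≥ 0`: it tends to `1` as `c → 0`, and
`t` times it is bounded by `1 / c`. -/
def cutoff (c t : ℝ) : ℝ := (1 + c * t)⁻¹

lemma cutoff_pos {c t : ℝ} (hc : 0 < c) (ht : 0 ≤ t) : 0 < cutoff c t := by
  unfold cutoff; positivity

lemma cutoff_le_one {c t : ℝ} (hc : 0 < c) (ht : 0 ≤ t) : cutoff c t ≤ 1 :=
  inv_le_one_of_one_le₀ (by nlinarith [mul_nonneg hc.le ht])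

lemma cutoff_mul_le {c t : ℝ} (hc : 0 < c) (ht : 0 ≤ t) : cutoff c t * t ≤ c⁻¹ := by
  have h : 0 < 1 + c * t := by positivity
  rw [cutoff, inv_mul_le_iff₀ h, add_mul, mul_comm c t, mul_assoc, mul_inv_cancel₀ hc.ne']
  linarith [inv_pos.mpr hc]

lemma continuous_cutoff_norm {V : Type*} [NormedAddCommGroup V] {c : ℝ} (hc : 0 < c) :
    Continuous fun v : V => cutoff c ‖v‖ :=
  (by fun_prop : Continuous fun v : V => 1 + c * ‖v‖).inv₀ fun v => by positivity

lemma aestronglyMeasurable_clm_apply {V W : Type*} [NormedAddCommGroup V] [NormedSpace ℝ V]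
    [NormedAddCommGroup W] [NormedSpace ℝ W] {T : X → V →L[ℝ] W} {f : X → V}
    (hT : AEStronglyMeasurable T μ) (hf : AEStronglyMeasurable f μ) :
    AEStronglyMeasurable (fun x => T x (f x)) μ :=
  (isBoundedBilinearMap_apply (𝕜 := ℝ) (E := V) (F := W)).continuous.comp_aestronglyMeasurable
    (hT.prodMk hf)

/-- Lower semicontinuity of `∫ ‖M g‖²` for almost everywhere convergent `M` and weakly convergent
`g`. No bound on the `M n` is assumed, so that `M n (g n)` need not be square integrable: this is
why the dual form `2⟪M g, w⟫ - ‖w‖² ≤ ‖M g‖²` is tested with fields `w` that are cut off where the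
operators or the limit of `g` are large. -/
theorem lintegral_enorm_sq_le_liminf [IsFiniteMeasure μ] {M : ℕ → X → E →L[ℝ] F}
    {M₀ : X → E →L[ℝ] F} (hM : ∀ n, AEStronglyMeasurable (M n) μ)
    (hM₀ : AEStronglyMeasurable M₀ μ)
    (hlim : ∀ᵐ x ∂μ, Tendsto (fun n => M n x) atTop (𝓝 (M₀ x))) {g : ℕ → X → E} {g₀ : X → E}
    (hg : ∀ n, MemLp (g n) 2 μ) (hg₀ : MemLp g₀ 2 μ) {R : ℝ}
    (hR : ∀ n, (eLpNorm (g n) 2 μ).toReal ≤ R) (hw : WeakTendsto μ g g₀) :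
    ∫⁻ x, ‖M₀ x (g₀ x)‖ₑ ^ 2 ∂μ ≤ liminf (fun n => ∫⁻ x, ‖M n x (g n x)‖ₑ ^ 2 ∂μ) atTop := by
  set L := liminf (fun n => ∫⁻ x, ‖M n x (g n x)‖ₑ ^ 2 ∂μ) atTop with hL
  have hMg : AEStronglyMeasurable (fun x => M₀ x (g₀ x)) μ :=
    aestronglyMeasurable_clm_apply hM₀ hg₀.1
  -- the cut off field
  let w : ℝ → X → F := fun c x => (cutoff c ‖M₀ x‖ * cutoff c ‖g₀ x‖) • M₀ x (g₀ x)
  have hwm : ∀ c, 0 < c → AEStronglyMeasurable (w c) μ := fun c hc =>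
    (((continuous_cutoff_norm hc).comp_aestronglyMeasurable hM₀).mul
      ((continuous_cutoff_norm hc).comp_aestronglyMeasurable hg₀.1)).smul hMg
  have hwb : ∀ c, 0 < c → ∀ x, ‖w c x‖ ≤ c⁻¹ * c⁻¹ := by
    intro c hc x
    have h1 := cutoff_pos hc (norm_nonneg (M₀ x))
    have h2 := cutoff_pos hc (norm_nonneg (g₀ x))
    rw [norm_smul, Real.norm_of_nonneg (mul_pos h1 h2).le]
    calc cutoff c ‖M₀ x‖ * cutoff c ‖g₀ x‖ * ‖M₀ x (g₀ x)‖
        ≤ cutoff c ‖M₀ x‖ * cutoff c ‖g₀ x‖ * (‖M₀ x‖ * ‖g₀ x‖) :=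
          mul_le_mul_of_nonneg_left ((M₀ x).le_opNorm _) (mul_pos h1 h2).le
      _ = (cutoff c ‖M₀ x‖ * ‖M₀ x‖) * (cutoff c ‖g₀ x‖ * ‖g₀ x‖) := by ring
      _ ≤ c⁻¹ * c⁻¹ := mul_le_mul (cutoff_mul_le hc (norm_nonneg _))
          (cutoff_mul_le hc (norm_nonneg _)) (by positivity) (by positivity)
  have key : ∀ c, 0 < c → ∫⁻ x, ‖w c x‖ₑ ^ 2 ∂μ ≤ L := by
    intro c hc
    have hwL : MemLp (w c) 2 μ := MemLp.of_bound (hwm c hc) _ (Eventually.of_forall (hwb c hc))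
    let v : (X → E →L[ℝ] F) → X → E := fun M x =>
      cutoff c ‖M x‖ • ContinuousLinearMap.adjoint (M x) (w c x)
    have hvm : ∀ {M : X → E →L[ℝ] F}, AEStronglyMeasurable M μ → AEStronglyMeasurable (v M) μ :=
      fun hM => ((continuous_cutoff_norm hc).comp_aestronglyMeasurable hM).smul
        (aestronglyMeasurable_clm_apply
          (ContinuousLinearMap.adjoint.continuous.comp_aestronglyMeasurable hM) (hwm c hc))
    have hvb : ∀ (M : X → E →L[ℝ] F) x, ‖v M x‖ ≤ c⁻¹ * (c⁻¹ * c⁻¹) := by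
      intro M x
      have h1 := cutoff_pos hc (norm_nonneg (M x))
      rw [norm_smul, Real.norm_of_nonneg h1.le]
      calc cutoff c ‖M x‖ * ‖ContinuousLinearMap.adjoint (M x) (w c x)‖
          ≤ cutoff c ‖M x‖ * (‖M x‖ * ‖w c x‖) := by
            refine mul_le_mul_of_nonneg_left ?_ h1.le
            refine (ContinuousLinearMap.le_opNorm _ _).trans ?_
            rw [LinearIsometryEquiv.norm_map]
        _ = (cutoff c ‖M x‖ * ‖M x‖) * ‖w c x‖ := by ring
        _ ≤ c⁻¹ * (c⁻¹ * c⁻¹) := mul_le_mul (cutoff_mul_le hc (norm_nonneg _)) (hwb c hc x)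
            (norm_nonneg _) (by positivity)
    have hvL : ∀ {M : X → E →L[ℝ] F}, AEStronglyMeasurable M μ → MemLp (v M) 2 μ := fun hM =>
      MemLp.of_bound (hvm hM) _ (Eventually.of_forall (hvb _))
    have hvlim : Tendsto (fun n => eLpNorm (fun x => v (M n) x - v M₀ x) 2 μ) atTop (𝓝 0) := by
      refine tendsto_eLpNorm_two_of_sq ?_
      simp only [eLpNorm_two_sq]
      have h := tendsto_lintegral_of_dominated_convergence' (μ := μ)
        (F := fun n x => ‖v (M n) x - v M₀ x‖ₑ ^ 2) (f := fun _ => 0)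
        (fun _ => ENNReal.ofReal ((c⁻¹ * (c⁻¹ * c⁻¹) + c⁻¹ * (c⁻¹ * c⁻¹)) ^ 2))
        (fun n => ((hvm (hM n)).sub (hvm hM₀)).enorm.pow_const 2)
        (fun n => Eventually.of_forall fun x => by
          beta_reduce
          rw [enorm_sq_eq_ofReal]
          refine ENNReal.ofReal_le_ofReal (pow_le_pow_left₀ (norm_nonneg _) ?_ 2)
          exact (norm_sub_le _ _).trans (add_le_add (hvb _ x) (hvb _ x)))
        (by
          rw [lintegral_const]
          exact ENNReal.mul_ne_top ENNReal.ofReal_ne_top (measure_ne_top _ _))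
        (by
          filter_upwards [hlim] with x hx
          have hc1 : Continuous fun T : E →L[ℝ] F =>
              cutoff c ‖T‖ • ContinuousLinearMap.adjoint T (w c x) :=
            (continuous_cutoff_norm hc).smul
              (ContinuousLinearMap.adjoint.continuous.clm_apply continuous_const)
          have h1 := ((hc1.tendsto (M₀ x)).comp hx).sub_const (v M₀ x)
          have h2 := (((ENNReal.continuous_pow 2).comp continuous_enorm).tendsto _).comp h1
          simpa [v, Function.comp_def] using h2)
      simpa using h
    have hI : Tendsto (fun n => ∫ x, inner ℝ (g n x) (v (M n) x) ∂μ) atTop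
        (𝓝 (∫ x, inner ℝ (g₀ x) (v M₀ x) ∂μ)) := by
      have h1 := (hw (v M₀) (hvL hM₀)).add (tendsto_integral_inner_zero hg hR
        (b := fun n x => v (M n) x - v M₀ x) (fun n => (hvL (hM n)).sub (hvL hM₀)) hvlim)
      rw [add_zero] at h1
      refine h1.congr fun n => ?_
      rw [← integral_add (integrable_inner_of_memLp (hg n) (hvL hM₀))
        (g := fun x => inner ℝ (g n x) (v (M n) x - v M₀ x))
        (integrable_inner_of_memLp (hg n) ((hvL (hM n)).sub (hvL hM₀)))]
      refine integral_congr_ae (Eventually.of_forall fun x => ?_)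
      simp only [← inner_add_right, add_sub_cancel]
    have hw2 : Integrable (fun x => ‖w c x‖ ^ 2) μ := hwL.integrable_norm_pow (by norm_num)
    have hadj : ∀ (M : X → E →L[ℝ] F) (g : X → E) x,
        inner ℝ (g x) (v M x) = cutoff c ‖M x‖ * inner ℝ (M x (g x)) (w c x) := by
      intro M g x
      rw [inner_smul_right, ContinuousLinearMap.adjoint_inner_right]
    have hn : ∀ n, ENNReal.ofReal (2 * (∫ x, inner ℝ (g n x) (v (M n) x) ∂μ) -
        ∫ x, ‖w c x‖ ^ 2 ∂μ) ≤ ∫⁻ x, ‖M n x (g n x)‖ₑ ^ 2 ∂μ := by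
      intro n
      have hi := (integrable_inner_of_memLp (hg n) (hvL (hM n))).const_mul 2
      rw [← integral_const_mul, ← integral_sub hi hw2]
      refine (ofReal_integral_le_lintegral (hi.sub hw2)).trans (lintegral_mono fun x => ?_)
      rw [enorm_sq_eq_ofReal]
      refine ENNReal.ofReal_le_ofReal ?_
      rw [Pi.sub_apply, hadj]
      have h1 := cutoff_pos hc (norm_nonneg (M n x))
      have h2 := cutoff_le_one hc (norm_nonneg (M n x))
      have h3 := real_inner_le_norm (M n x (g n x)) (w c x)
      have h4 : cutoff c ‖M n x‖ * inner ℝ (M n x (g n x)) (w c x) ≤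
          ‖M n x (g n x)‖ * ‖w c x‖ := by
        refine (mul_le_mul_of_nonneg_left h3 h1.le).trans ?_
        exact mul_le_of_le_one_left (by positivity) h2
      nlinarith [sq_nonneg (‖M n x (g n x)‖ - ‖w c x‖)]
    have hfin : ∫⁻ x, ‖w c x‖ₑ ^ 2 ∂μ ≤ ENNReal.ofReal
        (2 * (∫ x, inner ℝ (g₀ x) (v M₀ x) ∂μ) - ∫ x, ‖w c x‖ ^ 2 ∂μ) := by
      simp only [enorm_sq_eq_ofReal]
      rw [← ofReal_integral_eq_lintegral_ofReal hw2 (Eventually.of_forall fun x => sq_nonneg _)]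
      refine ENNReal.ofReal_le_ofReal ?_
      have h1 : ∫ x, ‖w c x‖ ^ 2 ∂μ ≤ ∫ x, inner ℝ (g₀ x) (v M₀ x) ∂μ := by
        refine integral_mono hw2 (integrable_inner_of_memLp hg₀ (hvL hM₀)) fun x => ?_
        simp only [hadj]
        have h1 := cutoff_pos hc (norm_nonneg (M₀ x))
        have h2 := cutoff_pos hc (norm_nonneg (g₀ x))
        have h3 := cutoff_le_one hc (norm_nonneg (g₀ x))
        rw [norm_smul, Real.norm_of_nonneg (mul_pos h1 h2).le, inner_smul_right,
          real_inner_self_eq_norm_sq]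
        have h4 : 0 ≤ cutoff c ‖M₀ x‖ ^ 2 * cutoff c ‖g₀ x‖ * ‖M₀ x (g₀ x)‖ ^ 2 := by positivity
        nlinarith [mul_nonneg h4 (sub_nonneg.mpr h3)]
      linarith
    refine hfin.trans ?_
    have ht := ENNReal.tendsto_ofReal ((hI.const_mul 2).sub_const (∫ x, ‖w c x‖ ^ 2 ∂μ))
    rw [← ht.liminf_eq]
    exact liminf_le_liminf (Eventually.of_forall hn)
  -- remove the cutoff
  have hc : ∀ k : ℕ, (0 : ℝ) < 1 / ((k : ℝ) + 1) := fun k => by positivity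
  have hwlim : ∀ x, Tendsto (fun k : ℕ => ‖w (1 / ((k : ℝ) + 1)) x‖ₑ ^ 2) atTop
      (𝓝 (‖M₀ x (g₀ x)‖ₑ ^ 2)) := by
    intro x
    have h1 : ∀ t : ℝ, Tendsto (fun k : ℕ => cutoff (1 / ((k : ℝ) + 1)) t) atTop (𝓝 1) := by
      intro t
      have := ((tendsto_one_div_add_atTop_nhds_zero_nat (𝕜 := ℝ)).mul_const t).const_add 1
      simpa [cutoff] using this.inv₀ (by simp)
    have h2 := ((h1 ‖M₀ x‖).mul (h1 ‖g₀ x‖)).smul_const (M₀ x (g₀ x))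
    rw [mul_one, one_smul] at h2
    exact (((ENNReal.continuous_pow 2).comp continuous_enorm).tendsto _).comp h2
  calc ∫⁻ x, ‖M₀ x (g₀ x)‖ₑ ^ 2 ∂μ
      = ∫⁻ x, liminf (fun k : ℕ => ‖w (1 / ((k : ℝ) + 1)) x‖ₑ ^ 2) atTop ∂μ :=
        lintegral_congr fun x => (hwlim x).liminf_eq.symm
    _ ≤ liminf (fun k : ℕ => ∫⁻ x, ‖w (1 / ((k : ℝ) + 1)) x‖ₑ ^ 2 ∂μ) atTop :=
        lintegral_liminf_le' fun k => (hwm _ (hc k)).enorm.pow_const 2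
    _ ≤ liminf (fun _ : ℕ => L) atTop :=
        liminf_le_liminf (Eventually.of_forall fun k => key _ (hc k))
    _ = L := liminf_const L

end LowerSemicontinuity

section Liminf

variable {X : Type*} [MeasurableSpace X] {μ : Measure X}

lemma add_le_liminf {a b : ℝ≥0∞} {u v : ℕ → ℝ≥0∞} (hu : a ≤ liminf u atTop)
    (hv : b ≤ liminf v atTop) : a + b ≤ liminf (fun n => u n + v n) atTop := by
  refine (add_le_add hu hv).trans ?_
  rw [liminf_eq_iSup_iInf_of_nat, liminf_eq_iSup_iInf_of_nat, liminf_eq_iSup_iInf_of_nat,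
    ENNReal.iSup_add_iSup_of_monotone]
  · exact iSup_mono fun n => le_iInf₂ fun i hi => add_le_add (iInf₂_le i hi) (iInf₂_le i hi)
  · exact fun m n hmn => biInf_mono fun i hi => hmn.trans hi
  · exact fun m n hmn => biInf_mono fun i hi => hmn.trans hi

lemma const_mul_le_liminf {a c : ℝ≥0∞} {u : ℕ → ℝ≥0∞} (hc : c ≠ ⊤) (hu : a ≤ liminf u atTop) :
    c * a ≤ liminf (fun n => c * u n) atTop := by
  rw [ENNReal.liminf_const_mul_of_ne_top hc]
  exact mul_le_mul_right hu c

lemma sum_le_liminf {ι : Type*} (s : Finset ι) {a : ι → ℝ≥0∞} {u : ι → ℕ → ℝ≥0∞}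
    (h : ∀ i, a i ≤ liminf (u i) atTop) :
    ∑ i ∈ s, a i ≤ liminf (fun n => ∑ i ∈ s, u i n) atTop := by
  classical
  induction s using Finset.induction_on with
  | empty => simp
  | insert i s hi ih =>
    simp only [Finset.sum_insert hi]
    exact add_le_liminf (h i) ih

lemma lintegral_ofReal_comp_le_liminf {V : Type*} [TopologicalSpace V] {h : V → ℝ}
    (hh : Continuous h) {f : ℕ → X → V} {f₀ : X → V} (hf : ∀ n, AEStronglyMeasurable (f n) μ)
    (hlim : ∀ᵐ x ∂μ, Tendsto (fun n => f n x) atTop (𝓝 (f₀ x))) :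
    ∫⁻ x, ENNReal.ofReal (h (f₀ x)) ∂μ ≤
      liminf (fun n => ∫⁻ x, ENNReal.ofReal (h (f n x)) ∂μ) atTop := by
  refine le_trans (le_of_eq ?_) (lintegral_liminf_le' fun n =>
    (hh.comp_aestronglyMeasurable (hf n)).aemeasurable.ennreal_ofReal)
  refine lintegral_congr_ae ?_
  filter_upwards [hlim] with x hx
  exact ((ENNReal.continuous_ofReal.comp hh).tendsto _ |>.comp hx).liminf_eq.symm

end Liminf

/-! ### The energy as an integral of nonnegative densities -/

section Energy

variable {Ω : Set E3}

/-- The linear map `v ↦ (Q + s/3 I) v` of the anchoring energy, for an array `Q` of entries. -/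
def anchorMap (s : ℝ) (a : Fin 3 → Fin 3 → ℝ) : E3 →L[ℝ] E3 :=
  Matrix.toEuclideanCLM (n := Fin 3) (𝕜 := ℝ)
    (Matrix.of a + (s / 3) • (1 : Matrix (Fin 3) (Fin 3) ℝ))

lemma continuous_matrix_of :
    Continuous fun a : Fin 3 → Fin 3 → ℝ => (Matrix.of a : Matrix (Fin 3) (Fin 3) ℝ) :=
  continuous_id

lemma continuous_anchorMap (s : ℝ) : Continuous (anchorMap s) := by
  have h : Continuous (Matrix.toEuclideanCLM (n := Fin 3) (𝕜 := ℝ)).toAlgEquiv.toLinearMap :=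
    LinearMap.continuous_of_finiteDimensional _
  exact h.comp (continuous_matrix_of.add continuous_const)

lemma continuous_bulk (A B C : ℝ) :
    Continuous fun a : Fin 3 → Fin 3 → ℝ => bulk A B C (Matrix.of a) := by
  have := continuous_matrix_of
  unfold bulk
  fun_prop

lemma continuous_frobSq : Continuous fun a : Fin 3 → Fin 3 → ℝ => frobSq (Matrix.of a) := by
  unfold frobSq
  simp only [Matrix.of_apply]
  fun_prop

/-- The bulk energy grows faster than `|Q|²`: the quartic term dominates the cubic one. -/
lemma exists_frobSq_le_bulk (p : Params) :
    ∃ c : ℝ, 0 ≤ c ∧ ∀ M ∈ S0, frobSq M ≤ p.lam ^ 2 * (bulk p.A p.B p.C M / p.C) + c := by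
  have hB := p.B_pos
  have hC := p.C_pos
  have hA := p.A_neg
  have hl := p.lam_pos
  set a := p.lam ^ 2 / p.C with ha
  have hapos : 0 < a := by positivity
  set D := a * (162 * p.B ^ 2 / p.C - p.A / 2) + 1 with hD
  set κ := a * p.C / 8 with hκ
  have hκpos : 0 < κ := by positivity
  refine ⟨D ^ 2 / (4 * κ), by positivity, fun M hM => ?_⟩
  obtain ⟨hsymm, -⟩ := hM
  set t := frobSq M with ht
  have ht0 : 0 ≤ t := Finset.sum_nonneg fun i _ => Finset.sum_nonneg fun j _ => sq_nonneg _
  have hentry : ∀ i j, M i j ^ 2 ≤ t := by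
    intro i j
    calc M i j ^ 2 ≤ ∑ j, M i j ^ 2 :=
          Finset.single_le_sum (f := fun j => M i j ^ 2) (fun j _ => sq_nonneg _)
            (Finset.mem_univ j)
      _ ≤ t := Finset.single_le_sum (f := fun i => ∑ j, M i j ^ 2)
          (fun i _ => Finset.sum_nonneg fun j _ => sq_nonneg _) (Finset.mem_univ i)
  have htr2 : (M ^ 2).trace = t := by
    rw [ht, frobSq, pow_two, Matrix.trace]
    refine Finset.sum_congr rfl fun i _ => ?_
    rw [Matrix.diag_apply, Matrix.mul_apply]
    refine Finset.sum_congr rfl fun j _ => ?_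
    have : M j i = M i j := congrFun (congrFun hsymm i) j
    rw [this, sq]
  have htr3 : p.B * (M ^ 3).trace ≤ 27 * (p.C / 72 * t ^ 2 + 18 * p.B ^ 2 / p.C * t) := by
    have hterm : ∀ i j k, p.B * (M i j * M j k * M k i) ≤
        p.C / 72 * t ^ 2 + 18 * p.B ^ 2 / p.C * t := by
      intro i j k
      have h1 := hentry i j
      have h2 := hentry j k
      have h3 := hentry k i
      have h4 : (M i j * M j k) ^ 2 ≤ t ^ 2 := by
        rw [mul_pow, sq t]; exact mul_le_mul h1 h2 (sq_nonneg _) ht0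
      -- Young's inequality for `x * y` with `x = M i j * M j k` and `y = B * M k i`
      have h5 : p.B * (M i j * M j k * M k i) ≤
          p.C / 72 * (M i j * M j k) ^ 2 + 18 * p.B ^ 2 / p.C * M k i ^ 2 := by
        have h6 : p.C / 72 * (M i j * M j k) ^ 2 + 18 * p.B ^ 2 / p.C * M k i ^ 2 -
            p.B * (M i j * M j k * M k i) =
            p.C / 72 * (M i j * M j k - 36 * p.B / p.C * M k i) ^ 2 := by
          field_simp
          ring
        have h7 : 0 ≤ p.C / 72 * (M i j * M j k - 36 * p.B / p.C * M k i) ^ 2 := by positivity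
        linarith
      refine h5.trans (add_le_add ?_ ?_)
      · exact mul_le_mul_of_nonneg_left h4 (by positivity)
      · exact mul_le_mul_of_nonneg_left h3 (by positivity)
    have e : p.B * (M ^ 3).trace = ∑ i, ∑ k, ∑ j, p.B * (M i j * M j k * M k i) := by
      simp only [pow_succ, pow_zero, one_mul, Matrix.trace, Matrix.diag_apply, Matrix.mul_apply,
        Finset.sum_mul, Finset.mul_sum]
    rw [e]
    calc _ ≤ ∑ _i : Fin 3, ∑ _k : Fin 3, ∑ _j : Fin 3,
          (p.C / 72 * t ^ 2 + 18 * p.B ^ 2 / p.C * t) :=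
          Finset.sum_le_sum fun i _ => Finset.sum_le_sum fun k _ => Finset.sum_le_sum fun j _ =>
            hterm i j k
      _ = _ := by simp; ring
  have hbulk : p.C / 8 * t ^ 2 - (162 * p.B ^ 2 / p.C - p.A / 2) * t ≤ bulk p.A p.B p.C M := by
    rw [bulk, htr2]
    have : 27 * (18 * p.B ^ 2 / p.C * t) = 3 * (162 * p.B ^ 2 / p.C * t) := by ring
    linarith
  have h1 : a * (p.C / 8 * t ^ 2 - (162 * p.B ^ 2 / p.C - p.A / 2) * t) ≤
      p.lam ^ 2 * (bulk p.A p.B p.C M / p.C) := by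
    have : p.lam ^ 2 * (bulk p.A p.B p.C M / p.C) = a * bulk p.A p.B p.C M := by
      rw [ha]; ring
    rw [this]
    exact mul_le_mul_of_nonneg_left hbulk hapos.le
  have h2 : κ * t ^ 2 - D * t + D ^ 2 / (4 * κ) = κ * (t - D / (2 * κ)) ^ 2 := by
    field_simp
    ring
  have h3 : 0 ≤ κ * (t - D / (2 * κ)) ^ 2 := by positivity
  have h4 : a * (p.C / 8 * t ^ 2 - (162 * p.B ^ 2 / p.C - p.A / 2) * t) =
      κ * t ^ 2 - D * t + t := by
    rw [hκ, hD]; ring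
  linarith

/-- The energy increased by the constant `c |Ω|`, written as a sum of integrals of nonnegative
functions, one for each kind of dependence on `(Q, φ)`. -/
def shiftedEnergy (p : Params) (c : ℝ) (Ω : Set E3) (q : (E3 → S0) × (E3 → ℝ)) : ℝ≥0∞ :=
  (∑ i, ∑ j, ENNReal.ofReal (1 / 2) * ∫⁻ x in Ω, ‖weakGradient Ω (entry q.1 i j) x‖ₑ ^ 2)
    + (∫⁻ x in Ω, ENNReal.ofReal (p.lam ^ 2 * (bulk p.A p.B p.C (q.1 x) / p.C) + c))
    + ENNReal.ofReal (p.ωp * p.lam) *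
      (ENNReal.ofReal p.eps * (∫⁻ x in Ω, ‖weakGradient Ω q.2 x‖ₑ ^ 2)
        + ∫⁻ x in Ω, ENNReal.ofReal (p.eps⁻¹ * (q.2 x ^ 2 * (1 - q.2 x) ^ 2)))
    + ENNReal.ofReal (p.ωa * p.lam) * (ENNReal.ofReal p.eps *
        ∫⁻ x in Ω, ‖anchorMap (sPlus p.A p.B p.C) (q.1 x : Matrix (Fin 3) (Fin 3) ℝ)
          (weakGradient Ω q.2 x)‖ₑ ^ 2)
    + ENNReal.ofReal (p.ωv * p.lam ^ 2) *
        ∫⁻ x in Ω, ENNReal.ofReal (1 / 2 * (1 - q.2 x) ^ 2 * frobSq (q.1 x))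

lemma extIntegral_eq_of_nonneg {f : E3 → ℝ} (hf : ∀ x, 0 ≤ f x) :
    extIntegral Ω f = ((∫⁻ x in Ω, ENNReal.ofReal (f x) : ℝ≥0∞) : EReal) := by
  have h : ∀ x, ENNReal.ofReal (-f x) = 0 := fun x =>
    ENNReal.ofReal_of_nonpos (neg_nonpos.mpr (hf x))
  simp [extIntegral, h]

/-- For densities bounded below by `-c`, the extended integral is the integral of the nonnegative
function `f + c` minus `c |Ω|`. -/
lemma extIntegral_eq_of_bounded_below (hb : Bornology.IsBounded Ω) {f : E3 → ℝ}
    (hfm : AEMeasurable f (volume.restrict Ω)) {c : ℝ} (hc : 0 ≤ c) (hf : ∀ x, 0 ≤ f x + c) :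
    extIntegral Ω f = ((∫⁻ x in Ω, ENNReal.ofReal (f x + c) : ℝ≥0∞) : EReal) -
      ((c * volume.real Ω : ℝ) : EReal) := by
  have hV : volume Ω ≠ ⊤ := hb.measure_lt_top.ne
  set P := ∫⁻ x in Ω, ENNReal.ofReal (f x) with hP
  set N := ∫⁻ x in Ω, ENNReal.ofReal (-f x) with hN
  set S := ∫⁻ x in Ω, ENNReal.ofReal (f x + c) with hS
  have hcV : ∫⁻ _ in Ω, ENNReal.ofReal c = ENNReal.ofReal (c * volume.real Ω) := by
    rw [lintegral_const, Measure.restrict_apply_univ, ENNReal.ofReal_mul hc,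
      measureReal_def, ENNReal.ofReal_toReal hV]
  have hsum : S + N = P + ENNReal.ofReal (c * volume.real Ω) := by
    have hneg : AEMeasurable (fun x => ENNReal.ofReal (-f x)) (volume.restrict Ω) :=
      hfm.neg.ennreal_ofReal
    rw [← hcV, hS, hN, ← lintegral_add_right' _ hneg, hP,
      ← lintegral_add_right _ measurable_const]
    refine lintegral_congr fun x => ?_
    rcases le_total 0 (f x) with h | h
    · rw [ENNReal.ofReal_of_nonpos (neg_nonpos.mpr h), add_zero, ENNReal.ofReal_add h hc]
    · rw [ENNReal.ofReal_of_nonpos h, zero_add,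
        ← ENNReal.ofReal_add (hf x) (neg_nonneg.mpr h)]
      congr 1
      ring
  have hNle : N ≤ ENNReal.ofReal (c * volume.real Ω) := by
    rw [← hcV]
    exact lintegral_mono fun x => ENNReal.ofReal_le_ofReal (by linarith [hf x])
  have hNfin : N ≠ ⊤ := ne_top_of_le_ne_top ENNReal.ofReal_ne_top hNle
  have hcV0 : 0 ≤ c * volume.real Ω := mul_nonneg hc measureReal_nonneg
  rw [extIntegral]
  change (P : EReal) - (N : EReal) = _
  rcases eq_or_ne P ⊤ with hPtop | hPfin
  · have hStop : S = ⊤ := by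
      rw [hPtop, top_add] at hsum
      exact (ENNReal.add_eq_top.mp hsum).resolve_right hNfin
    rw [hPtop, hStop, EReal.coe_ennreal_top, ← EReal.coe_ennreal_toReal hNfin, EReal.top_sub_coe,
      EReal.top_sub_coe]
  · have hSfin : S ≠ ⊤ := by
      intro h
      rw [h, top_add] at hsum
      exact ENNReal.add_ne_top.mpr ⟨hPfin, ENNReal.ofReal_ne_top⟩ hsum.symm
    have hreal : S.toReal + N.toReal = P.toReal + c * volume.real Ω := by
      rw [← ENNReal.toReal_add hSfin hNfin, hsum, ENNReal.toReal_add hPfin ENNReal.ofReal_ne_top,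
        ENNReal.toReal_ofReal hcV0]
    rw [← EReal.coe_ennreal_toReal hPfin, ← EReal.coe_ennreal_toReal hNfin,
      ← EReal.coe_ennreal_toReal hSfin, ← EReal.coe_sub, ← EReal.coe_sub, EReal.coe_eq_coe_iff]
    linarith

lemma ofReal_half_gradSq (Q : E3 → S0) (x : E3) :
    ENNReal.ofReal (1 / 2 * gradSq Ω Q x) =
      ∑ i, ∑ j, ENNReal.ofReal (1 / 2) * ‖weakGradient Ω (entry Q i j) x‖ₑ ^ 2 := by
  have h : ∀ i j, ∑ k, (weakGradient Ω (entry Q i j) x k) ^ 2 =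
      ‖weakGradient Ω (entry Q i j) x‖ ^ 2 := by
    intro i j
    rw [EuclideanSpace.norm_sq_eq]
    simp
  simp only [gradSq, h, enorm_sq_eq_ofReal]
  rw [ENNReal.ofReal_mul (by norm_num), ENNReal.ofReal_sum_of_nonneg
    (fun i _ => Finset.sum_nonneg fun j _ => sq_nonneg _), Finset.mul_sum]
  refine Finset.sum_congr rfl fun i _ => ?_
  rw [ENNReal.ofReal_sum_of_nonneg (fun j _ => sq_nonneg _), Finset.mul_sum]

lemma gradSq_nonneg (Q : E3 → S0) (x : E3) : 0 ≤ gradSq Ω Q x :=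
  Finset.sum_nonneg fun _ _ => Finset.sum_nonneg fun _ _ => Finset.sum_nonneg fun _ _ => sq_nonneg _

lemma MemH10.aemeasurable {u : E3 → ℝ} (hu : MemH10 Ω u) : AEMeasurable u (volume.restrict Ω) :=
  hu.memH1.memLp.1.aemeasurable

lemma MemH10.aemeasurable_weakGradient {u : E3 → ℝ} (hu : MemH10 Ω u) :
    AEMeasurable (weakGradient Ω u) (volume.restrict Ω) :=
  hu.memH1.memLp_weakGradient.1.aemeasurable

lemma MemH10S0.aestronglyMeasurable {Q : E3 → S0} (hQ : MemH10S0 Ω Q) :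
    AEStronglyMeasurable (fun x => (fun i j => entry Q i j x : Fin 3 → Fin 3 → ℝ))
      (volume.restrict Ω) :=
  (aemeasurable_pi_lambda _ fun i => aemeasurable_pi_lambda _ fun j =>
    (hQ i j).aemeasurable).aestronglyMeasurable

lemma MemH10S0.aemeasurable_bulk {Q : E3 → S0} (hQ : MemH10S0 Ω Q) (A B C : ℝ) :
    AEMeasurable (fun x => bulk A B C (Q x)) (volume.restrict Ω) :=
  ((continuous_bulk A B C).comp_aestronglyMeasurable hQ.aestronglyMeasurable).aemeasurable

lemma coe_mul_coe_ennreal {a : ℝ} (ha : 0 ≤ a) (X : ℝ≥0∞) :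
    (a : EReal) * (X : EReal) = ((ENNReal.ofReal a * X : ℝ≥0∞) : EReal) := by
  rw [EReal.coe_ennreal_mul, EReal.coe_ennreal_ofReal, max_eq_left ha]

lemma energy_eq (hb : Bornology.IsBounded Ω) (p : Params) {c : ℝ} (hc : 0 ≤ c)
    (hbulk : ∀ M ∈ S0, 0 ≤ p.lam ^ 2 * (bulk p.A p.B p.C M / p.C) + c)
    {q : (E3 → S0) × (E3 → ℝ)} (hQ : MemH10S0 Ω q.1) (hφ : MemH10 Ω q.2) :
    energy p Ω q = (shiftedEnergy p c Ω q : EReal) - ((c * volume.real Ω : ℝ) : EReal) := by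
  have hp := p.lam_pos
  have heps := p.eps_pos
  have h1 : energyLdG p Ω q.1 = (((∑ i, ∑ j, ENNReal.ofReal (1 / 2) *
      ∫⁻ x in Ω, ‖weakGradient Ω (entry q.1 i j) x‖ₑ ^ 2) +
      ∫⁻ x in Ω, ENNReal.ofReal (p.lam ^ 2 * (bulk p.A p.B p.C (q.1 x) / p.C) + c) : ℝ≥0∞) :
        EReal) - ((c * volume.real Ω : ℝ) : EReal) := by
    have hg : ∀ i j, AEMeasurable (fun x => ‖weakGradient Ω (entry q.1 i j) x‖ₑ ^ 2)
        (volume.restrict Ω) := fun i j => (hQ i j).aemeasurable_weakGradient.enorm.pow_const 2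
    have hgm : AEMeasurable (fun x => gradSq Ω q.1 x) (volume.restrict Ω) := by
      unfold gradSq
      refine Finset.aemeasurable_fun_sum _ fun i _ => Finset.aemeasurable_fun_sum _ fun j _ =>
        Finset.aemeasurable_fun_sum _ fun k _ => ?_
      exact (((EuclideanSpace.proj (𝕜 := ℝ) k).continuous.measurable.comp_aemeasurable
        (hQ i j).aemeasurable_weakGradient)).pow_const 2
    have hbm : AEMeasurable (fun x => p.lam ^ 2 * (bulk p.A p.B p.C (q.1 x) / p.C))
        (volume.restrict Ω) := ((hQ.aemeasurable_bulk _ _ _).div_const _).const_mul _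
    have hm : AEMeasurable (fun x => 1 / 2 * gradSq Ω q.1 x +
        p.lam ^ 2 * (bulk p.A p.B p.C (q.1 x) / p.C)) (volume.restrict Ω) :=
      (hgm.const_mul _).add hbm
    rw [energyLdG, extIntegral_eq_of_bounded_below hb hm hc (fun x => by
      have := gradSq_nonneg (Ω := Ω) q.1 x
      have := hbulk _ (q.1 x).2
      linarith)]
    congr 2
    have e : ∀ x, ENNReal.ofReal (1 / 2 * gradSq Ω q.1 x +
        p.lam ^ 2 * (bulk p.A p.B p.C (q.1 x) / p.C) + c) =
        (∑ i, ∑ j, ENNReal.ofReal (1 / 2) * ‖weakGradient Ω (entry q.1 i j) x‖ₑ ^ 2) +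
          ENNReal.ofReal (p.lam ^ 2 * (bulk p.A p.B p.C (q.1 x) / p.C) + c) := by
      intro x
      rw [add_assoc, ENNReal.ofReal_add (mul_nonneg (by norm_num) (gradSq_nonneg _ _))
        (hbulk _ (q.1 x).2), ofReal_half_gradSq]
    simp only [e]
    rw [lintegral_add_right' _ (hbm.add_const c).ennreal_ofReal,
      lintegral_finsetSum' _ fun i _ => Finset.aemeasurable_fun_sum _ fun j _ =>
        (hg i j).const_mul _]
    congr 1
    refine Finset.sum_congr rfl fun i _ => ?_
    rw [lintegral_finsetSum' _ fun j _ => (hg i j).const_mul _]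
    refine Finset.sum_congr rfl fun j _ => ?_
    rw [lintegral_const_mul' _ _ ENNReal.ofReal_ne_top]
  have hpot : ∀ x, 0 ≤ p.eps⁻¹ * (q.2 x ^ 2 * (1 - q.2 x) ^ 2) := fun x => by positivity
  have h2 : energyMix p Ω q.2 = ((ENNReal.ofReal p.eps *
      (∫⁻ x in Ω, ‖weakGradient Ω q.2 x‖ₑ ^ 2) +
      ∫⁻ x in Ω, ENNReal.ofReal (p.eps⁻¹ * (q.2 x ^ 2 * (1 - q.2 x) ^ 2)) : ℝ≥0∞) : EReal) := by
    rw [energyMix, extIntegral_eq_of_nonneg fun x => by positivity]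
    congr 1
    have e : ∀ x, ENNReal.ofReal (p.eps * ‖weakGradient Ω q.2 x‖ ^ 2 +
        p.eps⁻¹ * (q.2 x ^ 2 * (1 - q.2 x) ^ 2)) = ENNReal.ofReal p.eps *
        ‖weakGradient Ω q.2 x‖ₑ ^ 2 +
          ENNReal.ofReal (p.eps⁻¹ * (q.2 x ^ 2 * (1 - q.2 x) ^ 2)) := by
      intro x
      rw [ENNReal.ofReal_add (by positivity) (hpot x), ENNReal.ofReal_mul heps.le,
        enorm_sq_eq_ofReal]
    simp only [e]
    rw [lintegral_add_left' ((hφ.aemeasurable_weakGradient.enorm.pow_const 2).const_mul _),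
      lintegral_const_mul' _ _ ENNReal.ofReal_ne_top]
  have h3 : energyAnch p Ω q.1 q.2 = ((ENNReal.ofReal p.eps *
      ∫⁻ x in Ω, ‖anchorMap (sPlus p.A p.B p.C) (q.1 x : Matrix (Fin 3) (Fin 3) ℝ)
        (weakGradient Ω q.2 x)‖ₑ ^ 2 : ℝ≥0∞) : EReal) := by
    rw [energyAnch, extIntegral_eq_of_nonneg fun x => by positivity]
    congr 1
    rw [← lintegral_const_mul' _ _ ENNReal.ofReal_ne_top]
    refine lintegral_congr fun x => ?_
    rw [ENNReal.ofReal_mul heps.le, enorm_sq_eq_ofReal]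
    rfl
  have h4 : energyVoid Ω q.1 q.2 =
      ((∫⁻ x in Ω, ENNReal.ofReal (1 / 2 * (1 - q.2 x) ^ 2 * frobSq (q.1 x)) : ℝ≥0∞) : EReal) := by
    rw [energyVoid, extIntegral_eq_of_nonneg fun x => ?_]
    have : 0 ≤ frobSq (q.1 x : Matrix (Fin 3) (Fin 3) ℝ) :=
      Finset.sum_nonneg fun i _ => Finset.sum_nonneg fun j _ => sq_nonneg _
    positivity
  have hp1 : 0 ≤ p.ωp * p.lam := (mul_pos p.ωp_pos hp).le
  have hp2 : 0 ≤ p.ωa * p.lam := (mul_pos p.ωa_pos hp).le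
  have hp3 : 0 ≤ p.ωv * p.lam ^ 2 := (mul_pos p.ωv_pos (pow_pos hp 2)).le
  rw [energy, h1, h2, h3, h4, coe_mul_coe_ennreal hp1, coe_mul_coe_ennreal hp2,
    coe_mul_coe_ennreal hp3, shiftedEnergy]
  simp only [EReal.coe_ennreal_add, sub_eq_add_neg]
  ac_rfl

end Energy

/-! ### Existence of a minimizer -/

section Existence

variable {Ω : Set E3}

/-- A pair in the admissible set with finite energy: `Q = 0`, and a bump function for `φ`. -/
lemma exists_admissible_shiftedEnergy_ne_top (hΩ : IsOpen Ω) (hb : Bornology.IsBounded Ω)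
    (hne : Ω.Nonempty) (p : Params) (c V₀ : ℝ) :
    ∃ q ∈ admissible Ω V₀, shiftedEnergy p c Ω q ≠ ⊤ := by
  have : IsFiniteMeasure (volume.restrict Ω) := ⟨by
    rw [Measure.restrict_apply_univ]; exact hb.measure_lt_top⟩
  obtain ⟨x₀, hx₀⟩ := hne
  obtain ⟨f, hf1, hf2, hf3, hf4, hf5⟩ :=
    exists_contDiff_tsupport_subset (n := (⊤ : ℕ∞)) (hΩ.mem_nhds hx₀)
  have hf : IsTestFunction Ω f := ⟨hf3, hf2, hf1⟩
  have hpos : 0 < ∫ x, f x := hf.continuous.integral_pos_of_hasCompactSupport_nonneg_nonzero hf2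
    (fun x => (hf4 ⟨x, rfl⟩).1) (x := x₀) (by rw [hf5]; exact one_ne_zero)
  set φ : E3 → ℝ := fun x => V₀ / (∫ x, f x) * f x with hφdef
  have hφ : IsTestFunction Ω φ := hf.const_mul _
  obtain ⟨hφ1, hφg⟩ := hφ.memH10 hΩ
  obtain ⟨hz1, hzg⟩ := (IsTestFunction.zero Ω).memH10 hΩ
  have hgz : gradient (fun _ : E3 => (0 : ℝ)) = 0 := by
    ext x; simp [gradient]
  have hbd : ∀ {g : E3 → ℝ}, Continuous g → (∫⁻ x in Ω, ENNReal.ofReal (g x)) ≠ ⊤ := by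
    intro g hg
    have h1 : IntegrableOn g Ω := (hg.continuousOn.integrableOn_compact
      hb.isCompact_closure).mono_set subset_closure
    exact h1.lintegral_lt_top.ne
  have hgrad : (∫⁻ x in Ω, ‖weakGradient Ω φ x‖ₑ ^ 2) ≠ ⊤ := by
    rw [← eLpNorm_two_sq]
    exact ENNReal.pow_ne_top hφ1.memH1.memLp_weakGradient.eLpNorm_ne_top
  refine ⟨(fun _ => 0, φ), ⟨fun i j => hz1, hφ1, ?_⟩, ?_⟩
  · change ∫ x in Ω, φ x = V₀
    rw [setIntegral_eq_integral_of_forall_compl_eq_zero fun x hx => hφ.eq_zero_of_notMem hx,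
      hφdef, integral_const_mul, div_mul_cancel₀ _ hpos.ne']
  · have h1 : (∑ i : Fin 3, ∑ j : Fin 3, ENNReal.ofReal (1 / 2) *
        ∫⁻ x in Ω, ‖weakGradient Ω (entry (fun _ => 0) i j) x‖ₑ ^ 2) ≠ ⊤ := by
      refine ENNReal.sum_ne_top.mpr fun i _ => ENNReal.sum_ne_top.mpr fun j _ => ?_
      refine ENNReal.mul_ne_top ENNReal.ofReal_ne_top ?_
      rw [← eLpNorm_two_sq]
      exact ENNReal.pow_ne_top hz1.memH1.memLp_weakGradient.eLpNorm_ne_top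
    have h3 : (∫⁻ x in Ω, ‖anchorMap (sPlus p.A p.B p.C)
        (((0 : S0) : Matrix (Fin 3) (Fin 3) ℝ)) (weakGradient Ω φ x)‖ₑ ^ 2) ≠ ⊤ := by
      rw [← eLpNorm_two_sq]
      exact ENNReal.pow_ne_top ((anchorMap _ _).comp_memLp'
        hφ1.memH1.memLp_weakGradient).eLpNorm_ne_top
    have hφc := hφ.continuous
    have h2 := hbd (g := fun x => p.eps⁻¹ * (φ x ^ 2 * (1 - φ x) ^ 2)) (by fun_prop)
    have h4 := hbd (g := fun x => 1 / 2 * (1 - φ x) ^ 2 * frobSq ((0 : S0) : Matrix _ _ ℝ))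
      (by fun_prop)
    have h5 := hbd (g := fun _ => p.lam ^ 2 *
      (bulk p.A p.B p.C ((0 : S0) : Matrix _ _ ℝ) / p.C) + c) continuous_const
    have hm : ∀ {a : ℝ} {b : ℝ≥0∞}, b ≠ ⊤ → ENNReal.ofReal a * b ≠ ⊤ := fun h =>
      ENNReal.mul_ne_top ENNReal.ofReal_ne_top h
    have ha : ∀ {a b : ℝ≥0∞}, a ≠ ⊤ → b ≠ ⊤ → a + b ≠ ⊤ := fun h h' =>
      ENNReal.add_ne_top.mpr ⟨h, h'⟩
    exact ha (ha (ha (ha h1 h5) (hm (ha (hm hgrad) h2))) (hm (hm h3))) (hm h4)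

lemma H10Tendsto.congr_ae (hΩ : IsOpen Ω) {u : ℕ → E3 → ℝ} {v v' : E3 → ℝ} (h : H10Tendsto Ω u v)
    (hv : v =ᵐ[volume.restrict Ω] v') : H10Tendsto Ω u v' where
  memH10 := (h.memH10.congr_ae hΩ hv).1
  tendsto_eLpNorm := h.tendsto_eLpNorm.congr fun n => eLpNorm_congr_ae (by
    filter_upwards [hv] with x hx
    rw [hx])
  tendsto_ae := by
    filter_upwards [h.tendsto_ae, hv] with x hx hx'
    rwa [← hx']
  weakTendsto_gradient := h.weakTendsto_gradient.congr (fun _ => EventuallyEq.rfl)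
    (h.memH10.congr_ae hΩ hv).2.symm

/-- If the entries of the fields `Q n` converge, the limits are the entries of a field with values
in `S_0`. -/
lemma exists_entry_H10Tendsto (hΩ : IsOpen Ω) {Q : ℕ → E3 → S0}
    (h : ∀ i j, ∃ v, H10Tendsto Ω (fun n => entry (Q n) i j) v) :
    ∃ Q₀ : E3 → S0, ∀ i j, H10Tendsto Ω (fun n => entry (Q n) i j) (entry Q₀ i j) := by
  classical
  choose v hv using h
  let P : E3 → Matrix (Fin 3) (Fin 3) ℝ := fun x => Matrix.of fun i j => v i j x
  refine ⟨fun x => if hx : P x ∈ S0 then ⟨P x, hx⟩ else 0, fun i j => (hv i j).congr_ae hΩ ?_⟩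
  have hae : ∀ᵐ x ∂(volume.restrict Ω), ∀ i j,
      Tendsto (fun n => entry (Q n) i j x) atTop (𝓝 (v i j x)) :=
    ae_all_iff.mpr fun i => ae_all_iff.mpr fun j => (hv i j).tendsto_ae
  filter_upwards [hae] with x hx
  have hmem : P x ∈ S0 := by
    constructor
    · ext i j
      refine tendsto_nhds_unique (hx j i) ((hx i j).congr fun n => ?_)
      exact (congrFun (congrFun (Q n x).2.1 j) i).trans rfl
    · have h1 := tendsto_finsetSum Finset.univ fun i (_ : i ∈ Finset.univ) => hx i i
      refine tendsto_nhds_unique h1 (tendsto_const_nhds.congr fun n => ?_)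
      exact (Q n x).2.2.symm
  simp only [entry, dif_pos hmem]
  rfl

lemma lintegral_enorm_sq_le_liminf_of_weakTendsto {u : ℕ → E3 → ℝ} {v : E3 → ℝ}
    (hb : Bornology.IsBounded Ω) (hu : ∀ n, MemH10 Ω (u n)) (h : H10Tendsto Ω u v) {R : ℝ}
    (hR : ∀ n, (eLpNorm (weakGradient Ω (u n)) 2 (volume.restrict Ω)).toReal ≤ R) :
    ∫⁻ x in Ω, ‖weakGradient Ω v x‖ₑ ^ 2 ≤
      liminf (fun n => ∫⁻ x in Ω, ‖weakGradient Ω (u n) x‖ₑ ^ 2) atTop := by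
  have : IsFiniteMeasure (volume.restrict Ω) := ⟨by
    rw [Measure.restrict_apply_univ]; exact hb.measure_lt_top⟩
  exact lintegral_enorm_sq_le_liminf (M := fun _ _ => ContinuousLinearMap.id ℝ E3)
    (M₀ := fun _ => ContinuousLinearMap.id ℝ E3) (fun _ => aestronglyMeasurable_const)
    aestronglyMeasurable_const (Eventually.of_forall fun _ => tendsto_const_nhds)
    (fun n => (hu n).memH1.memLp_weakGradient) h.memH10.memH1.memLp_weakGradient hR
    h.weakTendsto_gradient

/-- Lower semicontinuity of the energy along sequences that converge in the sense of `H10Tendsto`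
and are bounded in `H_0^1`. -/
lemma shiftedEnergy_le_liminf (hb : Bornology.IsBounded Ω) (p : Params) (c : ℝ)
    {q : ℕ → (E3 → S0) × (E3 → ℝ)} {q₀ : (E3 → S0) × (E3 → ℝ)}
    (hQ : ∀ n, MemH10S0 Ω (q n).1) (hφ : ∀ n, MemH10 Ω (q n).2)
    (hQ₀ : ∀ i j, H10Tendsto Ω (fun n => entry (q n).1 i j) (entry q₀.1 i j))
    (hφ₀ : H10Tendsto Ω (fun n => (q n).2) q₀.2) {R : ℝ}
    (hRQ : ∀ i j n,
      (eLpNorm (weakGradient Ω (entry (q n).1 i j)) 2 (volume.restrict Ω)).toReal ≤ R)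
    (hRφ : ∀ n, (eLpNorm (weakGradient Ω (q n).2) 2 (volume.restrict Ω)).toReal ≤ R) :
    shiftedEnergy p c Ω q₀ ≤ liminf (fun n => shiftedEnergy p c Ω (q n)) atTop := by
  have : IsFiniteMeasure (volume.restrict Ω) := ⟨by
    rw [Measure.restrict_apply_univ]; exact hb.measure_lt_top⟩
  let a : (E3 → S0) → E3 → Fin 3 → Fin 3 → ℝ := fun Q x i j => entry Q i j x
  have ham : ∀ n, AEStronglyMeasurable (a (q n).1) (volume.restrict Ω) := fun n =>
    (hQ n).aestronglyMeasurable
  have ham₀ : AEStronglyMeasurable (a q₀.1) (volume.restrict Ω) :=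
    MemH10S0.aestronglyMeasurable fun i j => (hQ₀ i j).memH10
  have halim : ∀ᵐ x ∂(volume.restrict Ω),
      Tendsto (fun n => a (q n).1 x) atTop (𝓝 (a q₀.1 x)) := by
    filter_upwards [ae_all_iff.mpr fun i => ae_all_iff.mpr fun j => (hQ₀ i j).tendsto_ae] with x hx
    exact tendsto_pi_nhds.mpr fun i => tendsto_pi_nhds.mpr fun j => hx i j
  have hφm : ∀ n, AEStronglyMeasurable (q n).2 (volume.restrict Ω) := fun n =>
    (hφ n).memH1.memLp.1
  have hcont1 : Continuous fun m : Fin 3 → Fin 3 → ℝ =>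
      p.lam ^ 2 * (bulk p.A p.B p.C (Matrix.of m) / p.C) + c :=
    (((continuous_bulk _ _ _).div_const _).const_mul _).add_const c
  have hcont2 : Continuous fun t : ℝ => p.eps⁻¹ * (t ^ 2 * (1 - t) ^ 2) := by fun_prop
  have hcont4 : Continuous fun m : (Fin 3 → Fin 3 → ℝ) × ℝ =>
      1 / 2 * (1 - m.2) ^ 2 * frobSq (Matrix.of m.1) :=
    (by fun_prop : Continuous fun m : (Fin 3 → Fin 3 → ℝ) × ℝ => 1 / 2 * (1 - m.2) ^ 2).mul
      (continuous_frobSq.comp continuous_fst)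
  have hbulk := lintegral_ofReal_comp_le_liminf hcont1 ham halim
  have hpot := lintegral_ofReal_comp_le_liminf hcont2 hφm hφ₀.tendsto_ae
  have hvoid := lintegral_ofReal_comp_le_liminf (f := fun n x => (a (q n).1 x, (q n).2 x))
    (f₀ := fun x => (a q₀.1 x, q₀.2 x)) hcont4 (fun n => (ham n).prodMk (hφm n)) (by
      filter_upwards [halim, hφ₀.tendsto_ae] with x h1 h2
      exact h1.prodMk_nhds h2)
  have hanch := lintegral_enorm_sq_le_liminf
    (M := fun n x => anchorMap (sPlus p.A p.B p.C) (a (q n).1 x))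
    (M₀ := fun x => anchorMap (sPlus p.A p.B p.C) (a q₀.1 x))
    (fun n => (continuous_anchorMap _).comp_aestronglyMeasurable (ham n))
    ((continuous_anchorMap _).comp_aestronglyMeasurable ham₀)
    (by
      filter_upwards [halim] with x hx
      exact ((continuous_anchorMap _).tendsto _).comp hx)
    (fun n => (hφ n).memH1.memLp_weakGradient) hφ₀.memH10.memH1.memLp_weakGradient hRφ
    hφ₀.weakTendsto_gradient
  have hgrad := fun i j => lintegral_enorm_sq_le_liminf_of_weakTendsto hb
    (fun n => hQ n i j) (hQ₀ i j) (hRQ i j)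
  have hgradφ := lintegral_enorm_sq_le_liminf_of_weakTendsto hb hφ hφ₀ hRφ
  have htop : ∀ {r : ℝ}, ENNReal.ofReal r ≠ ⊤ := ENNReal.ofReal_ne_top
  exact add_le_liminf (add_le_liminf (add_le_liminf (add_le_liminf
    (sum_le_liminf _ fun i => sum_le_liminf _ fun j => const_mul_le_liminf htop (hgrad i j)) hbulk)
    (const_mul_le_liminf htop (add_le_liminf (const_mul_le_liminf htop hgradφ) hpot)))
    (const_mul_le_liminf htop (const_mul_le_liminf htop hanch)))
    (const_mul_le_liminf htop hvoid)

lemma le_div_of_ofReal_mul_le {a : ℝ} (ha : 0 < a) {x y : ℝ≥0∞}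
    (h : ENNReal.ofReal a * x ≤ y) : x ≤ y / ENNReal.ofReal a := by
  rw [ENNReal.le_div_iff_mul_le (Or.inl (ENNReal.ofReal_pos.mpr ha).ne')
    (Or.inl ENNReal.ofReal_ne_top), mul_comm]
  exact h

lemma le_add_one_of_sq_le {x S : ℝ≥0∞} (h : x ^ 2 ≤ S) : x ≤ S + 1 := by
  rcases le_total x 1 with hx | hx
  · exact hx.trans le_add_self
  · refine le_trans ?_ (h.trans le_self_add)
    calc x = x * 1 := (mul_one x).symm
      _ ≤ x * x := mul_le_mul_right hx x
      _ = x ^ 2 := (sq x).symm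

/-- Coercivity: a bound on the energy bounds the `H^1` norms of all entries of `Q` and of `φ`. -/
lemma exists_bound_of_shiftedEnergy_le (hb : Bornology.IsBounded Ω) (p : Params) {c : ℝ}
    (hbulk : ∀ M ∈ S0, frobSq M ≤ p.lam ^ 2 * (bulk p.A p.B p.C M / p.C) + c) {K : ℝ≥0∞}
    (hK : K ≠ ⊤) :
    ∃ R : ℝ≥0∞, R ≠ ⊤ ∧ ∀ q : (E3 → S0) × (E3 → ℝ), shiftedEnergy p c Ω q ≤ K →
      (∀ i j, eLpNorm (entry q.1 i j) 2 (volume.restrict Ω) ≤ R ∧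
        eLpNorm (weakGradient Ω (entry q.1 i j)) 2 (volume.restrict Ω) ≤ R) ∧
      eLpNorm q.2 2 (volume.restrict Ω) ≤ R ∧
      eLpNorm (weakGradient Ω q.2) 2 (volume.restrict Ω) ≤ R := by
  have heps := p.eps_pos
  have hωp : 0 < p.ωp * p.lam := mul_pos p.ωp_pos p.lam_pos
  set R₁ := K / ENNReal.ofReal (1 / 2) with hR₁
  set R₂ := K / ENNReal.ofReal (p.ωp * p.lam) with hR₂
  set R₃ := R₂ / ENNReal.ofReal p.eps with hR₃
  set R₄ := ENNReal.ofReal 4 * volume Ω + ENNReal.ofReal p.eps * R₂ with hR₄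
  have hdiv : ∀ {x : ℝ≥0∞} {a : ℝ}, x ≠ ⊤ → 0 < a → x / ENNReal.ofReal a ≠ ⊤ := fun hx ha =>
    ENNReal.div_ne_top hx (ENNReal.ofReal_pos.mpr ha).ne'
  have hR₁t : R₁ ≠ ⊤ := hdiv hK (by norm_num)
  have hR₂t : R₂ ≠ ⊤ := hdiv hK hωp
  have hR₃t : R₃ ≠ ⊤ := hdiv hR₂t heps
  have hR₄t : R₄ ≠ ⊤ := ENNReal.add_ne_top.mpr
    ⟨ENNReal.mul_ne_top ENNReal.ofReal_ne_top hb.measure_lt_top.ne,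
      ENNReal.mul_ne_top ENNReal.ofReal_ne_top hR₂t⟩
  refine ⟨K + R₁ + R₃ + R₄ + 1, by finiteness, fun q hq => ?_⟩
  have hR : ∀ {S x : ℝ≥0∞}, S ≤ K + R₁ + R₃ + R₄ → x ^ 2 ≤ S → x ≤ K + R₁ + R₃ + R₄ + 1 :=
    fun hS hx => le_add_one_of_sq_le (hx.trans hS)
  have hKle : K ≤ K + R₁ + R₃ + R₄ := le_add_right (le_add_right le_self_add)
  have hR₁le : R₁ ≤ K + R₁ + R₃ + R₄ := le_add_right (le_add_right le_add_self)
  have hR₃le : R₃ ≤ K + R₁ + R₃ + R₄ := le_add_right le_add_self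
  have hR₄le : R₄ ≤ K + R₁ + R₃ + R₄ := le_add_self
  rw [shiftedEnergy] at hq
  have hq4 := le_self_add.trans hq
  have hq3 := le_self_add.trans hq4
  have hmix := le_div_of_ofReal_mul_le hωp (le_add_self.trans hq3)
  have hq2 := le_self_add.trans hq3
  have hsum := le_self_add.trans hq2
  have hb2 := le_add_self.trans hq2
  refine ⟨fun i j => ⟨hR hKle ?_, hR hR₁le ?_⟩, hR hR₄le ?_, hR hR₃le ?_⟩
  · rw [eLpNorm_two_sq]
    refine le_trans (lintegral_mono fun x => ?_) hb2
    rw [enorm_sq_eq_ofReal]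
    refine ENNReal.ofReal_le_ofReal (le_trans ?_ (hbulk _ (q.1 x).2))
    rw [Real.norm_eq_abs, sq_abs]
    calc entry q.1 i j x ^ 2 ≤ ∑ j, entry q.1 i j x ^ 2 :=
          Finset.single_le_sum (f := fun j => entry q.1 i j x ^ 2) (fun j _ => sq_nonneg _)
            (Finset.mem_univ j)
      _ ≤ frobSq (q.1 x) := Finset.single_le_sum (f := fun i => ∑ j, entry q.1 i j x ^ 2)
          (fun i _ => Finset.sum_nonneg fun j _ => sq_nonneg _) (Finset.mem_univ i)
  · rw [eLpNorm_two_sq]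
    refine le_div_of_ofReal_mul_le (by norm_num) (le_trans ?_ hsum)
    refine (Finset.single_le_sum (f := fun j => ENNReal.ofReal (1 / 2) *
      ∫⁻ x in Ω, ‖weakGradient Ω (entry q.1 i j) x‖ₑ ^ 2) (fun _ _ => bot_le)
      (Finset.mem_univ j)).trans ?_
    exact Finset.single_le_sum (f := fun i => ∑ j, ENNReal.ofReal (1 / 2) *
      ∫⁻ x in Ω, ‖weakGradient Ω (entry q.1 i j) x‖ₑ ^ 2) (fun _ _ => bot_le) (Finset.mem_univ i)
  · rw [eLpNorm_two_sq]
    have hpt : ∀ x, ‖q.2 x‖ₑ ^ 2 ≤ ENNReal.ofReal 4 + ENNReal.ofReal p.eps *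
        ENNReal.ofReal (p.eps⁻¹ * (q.2 x ^ 2 * (1 - q.2 x) ^ 2)) := by
      intro x
      rw [enorm_sq_eq_ofReal, ← ENNReal.ofReal_mul heps.le, mul_inv_cancel_left₀ heps.ne',
        ← ENNReal.ofReal_add (by norm_num) (by positivity), Real.norm_eq_abs, sq_abs]
      refine ENNReal.ofReal_le_ofReal ?_
      set t := q.2 x
      -- either `t² ≤ 4` or `(1 - t)² ≥ 1`
      rcases le_total (t ^ 2) 4 with h | h
      · have : 0 ≤ t ^ 2 * (1 - t) ^ 2 := by positivity
        linarith
      · have h1 : 1 ≤ (1 - t) ^ 2 := by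
          rcases le_total 0 t with h0 | h0
          · have : 2 ≤ t := by nlinarith
            nlinarith
          · nlinarith
        nlinarith [mul_le_mul_of_nonneg_left h1 (sq_nonneg t)]
    refine (lintegral_mono hpt).trans ?_
    rw [lintegral_add_left measurable_const, lintegral_const, Measure.restrict_apply_univ,
      lintegral_const_mul' _ _ ENNReal.ofReal_ne_top]
    exact add_le_add_right (mul_le_mul_right (le_add_self.trans hmix) _) _
  · rw [eLpNorm_two_sq]
    exact le_div_of_ofReal_mul_le heps (le_self_add.trans hmix)

/-- The direct method: a minimizing sequence has a subsequence that converges to a minimizer. -/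
theorem exists_isMinOn_shiftedEnergy (hΩ : IsOpen Ω) (hb : Bornology.IsBounded Ω)
    (p : Params) {c V₀ : ℝ}
    (hbulk : ∀ M ∈ S0, frobSq M ≤ p.lam ^ 2 * (bulk p.A p.B p.C M / p.C) + c)
    (hfin : ∃ q ∈ admissible Ω V₀, shiftedEnergy p c Ω q ≠ ⊤) :
    ∃ q ∈ admissible Ω V₀, IsMinOn (shiftedEnergy p c Ω) (admissible Ω V₀) q := by
  have : IsFiniteMeasure (volume.restrict Ω) := ⟨by
    rw [Measure.restrict_apply_univ]; exact hb.measure_lt_top⟩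
  set m := sInf (shiftedEnergy p c Ω '' admissible Ω V₀) with hm
  have hlow : ∀ q ∈ admissible Ω V₀, m ≤ shiftedEnergy p c Ω q := fun q hq =>
    sInf_le ⟨q, hq, rfl⟩
  obtain ⟨qf, hqf, hqft⟩ := hfin
  have hmt : m ≠ ⊤ := ne_top_of_le_ne_top hqft (hlow qf hqf)
  have hseq : ∀ n : ℕ, ∃ q ∈ admissible Ω V₀,
      shiftedEnergy p c Ω q < m + ((n : ℝ≥0∞) + 1)⁻¹ := by
    intro n
    have h : m < m + ((n : ℝ≥0∞) + 1)⁻¹ := ENNReal.lt_add_right hmt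
      (ENNReal.inv_ne_zero.mpr
        (ENNReal.add_ne_top.mpr ⟨ENNReal.natCast_ne_top n, ENNReal.one_ne_top⟩))
    obtain ⟨_, ⟨q, hq, rfl⟩, hlt⟩ := sInf_lt_iff.mp h
    exact ⟨q, hq, hlt⟩
  choose q hq hqlt using hseq
  have hqK : ∀ n, shiftedEnergy p c Ω (q n) ≤ m + 1 := fun n =>
    (hqlt n).le.trans (add_le_add_right (by rw [ENNReal.inv_le_one]; exact le_add_self) _)
  obtain ⟨R, hR, hbd⟩ := exists_bound_of_shiftedEnergy_le hb p hbulk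
    (K := m + 1) (ENNReal.add_ne_top.mpr ⟨hmt, ENNReal.one_ne_top⟩)
  -- the entries of `Q` and the function `φ` as one finite family
  let u : Option (Fin 3 × Fin 3) → ℕ → E3 → ℝ := fun i n =>
    i.elim (q n).2 fun ij => entry (q n).1 ij.1 ij.2
  obtain ⟨σ, hσ, hlim⟩ := exists_subseq_forall_H10Tendsto hΩ hb (u := u)
    (fun i n => by
      cases i with
      | none => exact (hq n).2.1
      | some ij => exact (hq n).1 ij.1 ij.2) hR
    (fun i n => by
      cases i with
      | none => exact (hbd _ (hqK n)).2.1
      | some ij => exact ((hbd _ (hqK n)).1 ij.1 ij.2).1)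
    (fun i n => by
      cases i with
      | none => exact (hbd _ (hqK n)).2.2
      | some ij => exact ((hbd _ (hqK n)).1 ij.1 ij.2).2)
  obtain ⟨Q₀, hQ₀⟩ := exists_entry_H10Tendsto hΩ (Q := fun n => (q (σ n)).1)
    fun i j => hlim (some (i, j))
  obtain ⟨φ₀, hφ₀⟩ := hlim none
  replace hφ₀ : H10Tendsto Ω (fun n => (q (σ n)).2) φ₀ := hφ₀
  have hadm : (Q₀, φ₀) ∈ admissible Ω V₀ := by
    refine ⟨fun i j => (hQ₀ i j).memH10, hφ₀.memH10, ?_⟩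
    have h1 := weakTendsto_of_eLpNorm (fun n => (hq (σ n)).2.1.memH1.memLp) hφ₀.memH10.memH1.memLp
      hφ₀.tendsto_eLpNorm (fun _ => (1 : ℝ)) (memLp_const 1)
    have e : ∀ a : ℝ, inner ℝ a 1 = a := fun a => by simp
    simp only [e, (hq _).2.2] at h1
    exact tendsto_nhds_unique h1 tendsto_const_nhds
  refine ⟨(Q₀, φ₀), hadm, fun q' hq' => ?_⟩
  have hlsc := shiftedEnergy_le_liminf hb p c (q := fun n => q (σ n)) (q₀ := (Q₀, φ₀))
    (fun n => (hq (σ n)).1) (fun n => (hq (σ n)).2.1) hQ₀ hφ₀ (R := R.toReal)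
    (fun i j n => ENNReal.toReal_mono hR ((hbd _ (hqK (σ n))).1 i j).2)
    (fun n => ENNReal.toReal_mono hR (hbd _ (hqK (σ n))).2.2)
  have hinv : Tendsto (fun n : ℕ => m + ((n : ℝ≥0∞) + 1)⁻¹) atTop (𝓝 m) := by
    have h1 := (tendsto_add_atTop_iff_nat 1).mpr ENNReal.tendsto_inv_nat_nhds_zero
    simpa using h1.const_add m
  have hle : liminf (fun n => shiftedEnergy p c Ω (q (σ n))) atTop ≤ m := by
    rw [← (hinv.comp hσ.tendsto_atTop).liminf_eq]
    exact liminf_le_liminf (Eventually.of_forall fun n => (hqlt (σ n)).le)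
  exact (hlsc.trans hle).trans (hlow q' hq')

end Existence

end LdG

end

theorem proposition3p2 (Ω : Set LdG.E3) (hΩ_open : IsOpen Ω) (hΩ_bdd : Bornology.IsBounded Ω)
    (p : LdG.Params) (V₀ : ℝ) (hV₀_pos : 0 < V₀) (hV₀_lt : ENNReal.ofReal V₀ < volume Ω) :
    ∃ q ∈ LdG.admissible Ω V₀,
      LdG.energy p Ω q ≠ ⊥ ∧ LdG.energy p Ω q ≠ ⊤ ∧
        IsMinOn (LdG.energy p Ω) (LdG.admissible Ω V₀) q := by
  have hne : Ω.Nonempty := nonempty_of_measure_ne_zero (bot_le.trans_lt hV₀_lt).ne'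
  obtain ⟨c, hc, hbulk⟩ := LdG.exists_frobSq_le_bulk p
  have hfin := LdG.exists_admissible_shiftedEnergy_ne_top hΩ_open hΩ_bdd hne p c V₀
  obtain ⟨q, hq, hmin⟩ := LdG.exists_isMinOn_shiftedEnergy hΩ_open hΩ_bdd p hbulk hfin
  have heq : ∀ q ∈ LdG.admissible Ω V₀, LdG.energy p Ω q =
      (LdG.shiftedEnergy p c Ω q : EReal) - ((c * volume.real Ω : ℝ) : EReal) := fun q hq =>
    LdG.energy_eq hΩ_bdd p hc (fun M hM => le_trans (Finset.sum_nonneg fun i _ =>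
      Finset.sum_nonneg fun j _ => sq_nonneg _) (hbulk M hM)) hq.1 hq.2.1
  have htop : LdG.shiftedEnergy p c Ω q ≠ ⊤ := by
    obtain ⟨q', hq', h⟩ := hfin
    exact ne_top_of_le_ne_top h (hmin hq')
  have hreal : LdG.energy p Ω q =
      (((LdG.shiftedEnergy p c Ω q).toReal - c * volume.real Ω : ℝ) : EReal) := by
    rw [heq q hq, ← EReal.coe_ennreal_toReal htop, EReal.coe_sub]
  refine ⟨q, hq, ?_, ?_, fun q' hq' => ?_⟩
  · rw [hreal]; exact EReal.coe_ne_bot _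
  · rw [hreal]; exact EReal.coe_ne_top _
  · change LdG.energy p Ω q ≤ LdG.energy p Ω q'
    rw [heq q hq, heq q' hq']
    exact EReal.sub_le_sub (EReal.coe_ennreal_le_coe_ennreal_iff.mpr (hmin hq')) le_rfl
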